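/- All groups are finite and $p$ is a prime. For a group $X$ let $\nu_p(X)$ be the number of Sylow $p$-subgroups of $X$; say that $X$ satisfies $\mathbf{DivSyl}(p)$ if $\nu_p(H)$ divides $\nu_p(X)$ for every subgroup $H\le X$. For subgroups $B\unlhd A$ of a group $G$ put $N_G(A/B)=N_G(A)\cap N_G(B)$. Every $x\in N_G(A/B)$ induces by conjugation an automorphism of $A/B$, and $\mathrm{Aut}_G(A/B)\le\mathrm{Aut}(A/B)$ denotes the group of all automorphisms of $A/B$ obtained in this way. If $S=A/B$ is nonabelian simple, then $S$ is identified with its group of inner automorphisms $\mathrm{Inn}(S)\le\mathrm{Aut}_G(A/B)$, so that for $P\le\mathrm{Aut}_G(A/B)$ the product $PS=P\,\mathrm{Inn}(S)$ is a subgroup of $\mathrm{Aut}_G(A/B)$. A composition series of $G$ is called an $(rc)$-series if it is a refinement of a chief series of $G$. Theorem. Let $1=G_0<G_1<\dots<G_n=G$ be an $(rc)$-series of a finite group $G$. Assume that, for each nonabelian factor $G_i/G_{i-1}$ and for every $p$-subgroup $P$ of $\mathrm{Aut}_G(G_i/G_{i-1})$, the group $P(G_i/G_{i-1})$ satisfies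 $\mathbf{DivSyl}(p)$. Then $G$ satisfies $\mathbf{DivSyl}(p)$. -/

import Mathlib

/-- `DivSyl(p)`: the number of Sylow `p`-subgroups of any subgroup divides that of the group. -/
def DivSyl (p : ℕ) (G : Type*) [Group G] : Prop :=
  ∀ H : Subgroup G, Nat.card (Sylow p H) ∣ Nat.card (Sylow p G)

section InducedAutomorphisms

variable {G : Type*} [Group G]

/-- The normalizer `N_G(A/B) = N_G(A) ∩ N_G(B)` of the section `A/B`. -/
def sectionNormalizer (A B : Subgroup G) : Subgroup G :=
  Subgroup.normalizer (A : Set G) ⊓ Subgroup.normalizer (B : Set G)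

/-- The conjugation action `N_G(A/B) → Aut(A)`, `x ↦ (a ↦ x a x⁻¹)`. -/
def sectionConj (A B : Subgroup G) : sectionNormalizer A B →* MulAut A :=
  (Subgroup.normalizerMonoidHom A).comp (Subgroup.inclusion inf_le_left)

theorem coe_sectionConj (A B : Subgroup G) (x : sectionNormalizer A B) (a : A) :
    (sectionConj A B x a : G) = (x : G) * a * (x : G)⁻¹ := rfl

theorem map_sectionConj (A B : Subgroup G) (x : sectionNormalizer A B) :
    (B.subgroupOf A).map (sectionConj A B x).toMonoidHom = B.subgroupOf A := by
  have hx := fun b => Subgroup.mem_normalizer_iff.mp x.2.2 b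
  ext a
  rw [Subgroup.mem_map_equiv, Subgroup.mem_subgroupOf, Subgroup.mem_subgroupOf, hx,
    ← coe_sectionConj, MulEquiv.apply_symm_apply]

/-- The homomorphism `N_G(A/B) → Aut(A/B)` sending `x` to `aB ↦ (x a x⁻¹)B`. -/
def sectionAction (A B : Subgroup G) [(B.subgroupOf A).Normal] :
    sectionNormalizer A B →* MulAut (A ⧸ B.subgroupOf A) where
  toFun x := QuotientGroup.congr _ _ (sectionConj A B x) (map_sectionConj A B x)
  map_one' := by
    ext a
    induction a using QuotientGroup.induction_on with
    | H a => simp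
  map_mul' x y := by
    ext a
    induction a using QuotientGroup.induction_on with
    | H a => simp only [map_mul]; rfl

/-- The group `Aut_G(A/B)` of `G`-induced automorphisms of the section `A/B`. -/
def inducedAut (A B : Subgroup G) [(B.subgroupOf A).Normal] :
    Subgroup (MulAut (A ⧸ B.subgroupOf A)) :=
  (sectionAction A B).range

end InducedAutomorphisms

/-- A composition series `1 = G₀ < G₁ < ⋯ < Gₙ = G` of the group `G`. -/
structure GroupCompositionSeries (G : Type*) [Group G] where
  /-- the number `n` of factors -/
  length : ℕ
  /-- the terms `G₀, …, Gₙ` -/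
  term : Fin (length + 1) → Subgroup G
  term_zero : term 0 = ⊥
  term_last : term (Fin.last length) = ⊤
  term_lt (i : Fin length) : term i.castSucc < term i.succ
  normal (i : Fin length) : ((term i.castSucc).subgroupOf (term i.succ)).Normal
  simple (i : Fin length) :
    IsSimpleGroup (term i.succ ⧸ (term i.castSucc).subgroupOf (term i.succ))

attribute [instance] GroupCompositionSeries.normal

/-- A chief series of `G`: a strictly increasing series from `1` to `G` of normal subgroups of `G`
in which no normal subgroup of `G` lies strictly between two consecutive terms. -/
structure IsChiefSeries {G : Type*} [Group G] {m : ℕ} (t : Fin (m + 1) → Subgroup G) : Prop where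
  zero : t 0 = ⊥
  last : t (Fin.last m) = ⊤
  normal (i : Fin (m + 1)) : (t i).Normal
  lt (i : Fin m) : t i.castSucc < t i.succ
  minimal (i : Fin m) (K : Subgroup G) : K.Normal → t i.castSucc ≤ K → K ≤ t i.succ →
    K = t i.castSucc ∨ K = t i.succ

namespace GroupCompositionSeries

variable {G : Type*} [Group G]

/-- An `(rc)`-series is a composition series that refines a chief series. -/
def IsRC (S : GroupCompositionSeries G) : Prop :=
  ∃ (m : ℕ) (t : Fin (m + 1) → Subgroup G), IsChiefSeries t ∧ Set.range t ⊆ Set.range S.term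

/-- The `i`-th factor of a composition series. -/
abbrev Factor (S : GroupCompositionSeries G) (i : Fin S.length) : Type _ :=
  S.term i.succ ⧸ (S.term i.castSucc).subgroupOf (S.term i.succ)

/-- The group of `G`-induced automorphisms of the `i`-th factor. -/
abbrev factorAut (S : GroupCompositionSeries G) (i : Fin S.length) :
    Subgroup (MulAut (S.Factor i)) :=
  inducedAut (S.term i.succ) (S.term i.castSucc)

end GroupCompositionSeries

/-!
The number of Sylow `p`-subgroups is multiplicative along a homomorphism `f` in the following sense:
if `Q` is a Sylow `p`-subgroup of `H`, then `H` has as many Sylow `p`-subgroups as `f(H)` times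
`Q(H ∩ ker f)` (`card_sylow_eq_mul`). Hence `DivSyl(p)` passes from `G/A` to `G/B` for a chief factor
`A/B` as soon as `P(A/B)` satisfies it for the Sylow `p`-subgroups `P` of `G/B`
(`divSyl_of_surjective`), and it is insensitive to normal `p`-subgroups
(`divSyl_iff_of_surjective`). Going down a chief series, it remains to treat `PN`, where `N` is a
minimal normal subgroup of a group and `P` is a `p`-group.

Let `S` be the first term of the composition series above the bottom of the chief factor; it is a
simple subnormal subgroup contained in `N`. If it is abelian, then `N` is an abelian
`q`-group and `N_N(P) ≤ N_N(Q)` for `Q ≤ P` gives the claim when `q ≠ p`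
(`divSyl_sup_of_commutative`). Otherwise the conjugates of `S` commute pairwise
(`eq_or_le_centralizer_of_isSubnormal`), so that `N` is their direct product, and each orbit of `P`
on them can be treated separately (`divSyl_sup_sSup`).

So let `M` be the direct product of the `P`-conjugates of `S`, with `P` a Sylow `p`-subgroup of `PM`.
Let `H ≤ PM` have the Sylow `p`-subgroup `Q ≤ P`, and put `K = H ∩ M`. The number of Sylow
`p`-subgroups of `H` is `|K : N_K(Q)|`. Multiplying the conjugates of an element of `H ∩ S` over a
transversal of `R = N_Q(S)` in `Q` shows that the order of `N_{H ∩ S}(R)` divides that of `N_K(Q)`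
(`exists_mem_normalizer_of_mem`), so the number divides `|K : H ∩ S|` times the number of Sylow
`p`-subgroups of `R(H ∩ S)`. Conversely, the projection to `S` shows that, up to a power of `p`, the
order of `N_M(P)` divides that of the normalizer of `N_P(S)` in `S` (`card_inf_normalizer_dvd`), so
that `|M : S|` times the number of Sylow `p`-subgroups of `N_P(S)S` divides a power of `p` times the
number of those of `PM`. The hypothesis compares `R(H ∩ S)` with `N_P(S)S`; as the number of Sylow
`p`-subgroups is prime to `p`, the result for `PM` follows (`divSyl_sup_conjOrbit`). Here `Q`
need not permute the conjugates of `S` transitively.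
-/

namespace SylowDivisibility

open Subgroup
open scoped Pointwise commutatorElement

/-! ### Indices and products of subgroups -/

section Indices

variable {G : Type*} [Group G]

theorem relIndex_sup_of_le_normalizer {H N : Subgroup G} (h : H ≤ normalizer (N : Set G)) :
    N.relIndex (H ⊔ N) = N.relIndex H := by
  have := normal_subgroupOf_of_le_normalizer h
  have := normal_subgroupOf_sup_of_le_normalizer h
  exact Nat.card_congr (QuotientGroup.quotientInfEquivProdNormalizerQuotient H N h).toEquiv.symm

theorem exists_mul_of_mem_sup {H N : Subgroup G} (h : H ≤ normalizer (N : Set G)) {x : G}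
    (hx : x ∈ H ⊔ N) : ∃ a ∈ H, ∃ b ∈ N, a * b = x := by
  have hx' : x ∈ ((H ⊔ N : Subgroup G) : Set G) := hx
  rw [coe_mul_of_left_le_normalizer_right H N h] at hx'
  exact Set.mem_mul.mp hx'

/-- **Lagrange's theorem** for a pair of nested subgroups. -/
theorem card_mul_relIndex {H K : Subgroup G} (h : H ≤ K) :
    Nat.card H * H.relIndex K = Nat.card K := by
  rw [← relIndex_bot_left, ← relIndex_bot_left, relIndex_mul_relIndex ⊥ H K bot_le h]

/-- A factorization `H = (A ∩ H) K` with `K` normal in `H` preserves the index of `A`. -/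
theorem relIndex_eq_of_le_inf_sup [Finite G] {A H K : Subgroup G} (hK : K ≤ H)
    (hn : H ≤ normalizer (K : Set G)) (h : H ≤ (A ⊓ H) ⊔ K) :
    A.relIndex H = A.relIndex K := by
  have e : (A ⊓ H) ⊔ K = H := le_antisymm (sup_le inf_le_right hK) h
  have h1 : K.relIndex H = K.relIndex (A ⊓ H) := by
    conv_lhs => rw [← e]
    exact relIndex_sup_of_le_normalizer (inf_le_right.trans hn)
  have h2 : Nat.card ↥(A ⊓ H) * (A ⊓ H).relIndex H = Nat.card H := card_mul_relIndex inf_le_right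
  have h3 : Nat.card K * K.relIndex H = Nat.card H := card_mul_relIndex hK
  have h4 : Nat.card ↥(K ⊓ (A ⊓ H)) * (K ⊓ (A ⊓ H)).relIndex (A ⊓ H) = Nat.card ↥(A ⊓ H) :=
    card_mul_relIndex inf_le_right
  have h5 : Nat.card ↥(A ⊓ K) * (A ⊓ K).relIndex K = Nat.card K := card_mul_relIndex inf_le_right
  have e2 : K ⊓ (A ⊓ H) = A ⊓ K := by
    rw [inf_left_comm, inf_eq_left.mpr hK]
  rw [inf_relIndex_right] at h2 h4 h5
  rw [e2] at h4
  have p1 : 0 < Nat.card ↥(A ⊓ K) := Nat.card_pos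
  have p2 : 0 < K.relIndex (A ⊓ H) := Nat.pos_of_mul_pos_left (h4 ▸ Nat.card_pos)
  rw [h1] at h3
  have : Nat.card ↥(A ⊓ K) * K.relIndex (A ⊓ H) * A.relIndex H =
      Nat.card ↥(A ⊓ K) * K.relIndex (A ⊓ H) * A.relIndex K := by
    rw [h4, h2, ← h3, ← h5, mul_right_comm, h4]
  exact Nat.eq_of_mul_eq_mul_left (Nat.mul_pos p1 p2) this

/-- If the image of `A` in `N_G(C)/C` is contained in the image of `B`, then its order divides the
order of `B`. -/
theorem relIndex_dvd_card_of_exists {A B C : Subgroup G} (hA : A ≤ normalizer (C : Set G))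
    (hB : B ≤ normalizer (C : Set G)) (h : ∀ x ∈ A, ∃ y ∈ B, x⁻¹ * y ∈ C) :
    C.relIndex A ∣ Nat.card B := by
  have hle : A ≤ B ⊔ C := fun x hx ↦ by
    obtain ⟨y, hy, hc⟩ := h x hx
    have : x = y * (x⁻¹ * y)⁻¹ := by group
    rw [this]
    exact mul_mem (mem_sup_left hy) (mem_sup_right (inv_mem hc))
  rw [← relIndex_sup_of_le_normalizer hA]
  refine dvd_trans ?_ (relIndex_dvd_card C B)
  rw [← relIndex_sup_of_le_normalizer hB]
  exact Dvd.intro _ (relIndex_mul_relIndex C (A ⊔ C) (B ⊔ C) le_sup_right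
    (sup_le hle le_sup_right))

theorem mem_normalizer_iff_conj_smul {H : Subgroup G} {g : G} :
    g ∈ normalizer (H : Set G) ↔ MulAut.conj g • H = H := by
  rw [← inv_mem_iff, mem_normalizer_iff, SetLike.ext_iff]
  refine forall_congr' fun x ↦ ?_
  rw [mem_pointwise_smul_iff_inv_smul_mem, ← map_inv, MulAut.smul_def, MulAut.conj_apply]
  exact Iff.comm

end Indices

/-! ### Sylow subgroups of subgroups -/

section Sylow

variable {G : Type*} [Group G]

/-- `Q` is a Sylow `p`-subgroup of the subgroup `H`, with both viewed inside an ambient group: the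
index of the `p`-group `Q` in `H` is not divisible by `p` (and so not `0`, the value for an infinite
index). -/
structure IsSylowOf (p : ℕ) (Q H : Subgroup G) : Prop where
  le : Q ≤ H
  isPGroup : IsPGroup p Q
  not_dvd : ¬ p ∣ Q.relIndex H

variable {p : ℕ} {P Q H K L : Subgroup G}

theorem IsSylowOf.of_le (h : IsSylowOf p Q H) (hQ : Q ≤ L) (hL : L ≤ H) : IsSylowOf p Q L :=
  ⟨hQ, h.isPGroup, fun hd ↦ h.not_dvd (hd.trans
    (Dvd.intro _ (relIndex_mul_relIndex Q L H hQ hL)))⟩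

theorem IsSylowOf.conj_smul (h : IsSylowOf p Q H) (x : G) :
    IsSylowOf p (MulAut.conj x • Q) (MulAut.conj x • H) where
  le := pointwise_smul_le_pointwise_smul_iff.mpr h.le
  isPGroup := h.isPGroup.map _
  not_dvd := by
    rw [relIndex_pointwise_smul]
    exact h.not_dvd

theorem IsSylowOf.inf_of_normal [Finite G] (h : IsSylowOf p Q H) (hK : K ≤ H)
    (hn : H ≤ normalizer (K : Set G)) : IsSylowOf p (Q ⊓ K) K := by
  refine ⟨inf_le_right, h.isPGroup.to_le inf_le_left, fun hd ↦ h.not_dvd ?_⟩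
  rw [inf_relIndex_right] at hd
  have h1 : Q.relIndex (Q ⊔ K) = Q.relIndex K := by
    refine relIndex_eq_of_le_inf_sup le_sup_right ?_ ?_
    · exact (sup_le h.le hK).trans hn
    · exact sup_le (le_sup_of_le_left (le_inf le_rfl le_sup_left)) le_sup_right
  rw [← h1] at hd
  exact hd.trans (Dvd.intro _ (relIndex_mul_relIndex Q (Q ⊔ K) H le_sup_left (sup_le h.le hK)))

variable [Fact p.Prime]

/-- If the index of `K` in `H` is a power of `p`, then `H = QK` for a Sylow `p`-subgroup `Q`. -/
theorem IsSylowOf.le_sup (h : IsSylowOf p Q H)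
    (hi : ∃ n : ℕ, K.relIndex H = p ^ n) : H ≤ Q ⊔ K := by
  obtain ⟨n, hn⟩ := hi
  rw [← relIndex_eq_one]
  have h1 : (Q ⊔ K).relIndex H ∣ p ^ n := hn ▸ relIndex_dvd_of_le_left H le_sup_right
  have h2 : (Q ⊔ K).relIndex H ∣ Q.relIndex H := relIndex_dvd_of_le_left H le_sup_left
  have h3 : Nat.Coprime (p ^ n) (Q.relIndex H) :=
    ((Nat.Prime.coprime_iff_not_dvd Fact.out).mpr h.not_dvd).pow_left n
  exact Nat.eq_one_of_dvd_coprimes h3 h1 h2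

variable [Finite G]

/-- An `IsSylowOf` pair as a bundled Sylow subgroup. -/
noncomputable def IsSylowOf.toSylow (h : IsSylowOf p Q H) : Sylow p H :=
  IsPGroup.toSylow (P := Q.subgroupOf H)
    (h.isPGroup.comap_of_injective H.subtype H.subtype_injective) h.not_dvd

theorem isSylowOf_map_subtype (Q : Sylow p H) :
    IsSylowOf p ((Q : Subgroup H).map H.subtype) H where
  le := map_subtype_le _
  isPGroup := Q.isPGroup'.map _
  not_dvd := by
    rw [relIndex, subgroupOf, comap_map_eq_self_of_injective H.subtype_injective]
    exact Q.not_dvd_index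

theorem exists_isSylowOf_of_isPGroup (hP : IsPGroup p P) (hPH : P ≤ H) :
    ∃ Q, P ≤ Q ∧ IsSylowOf p Q H := by
  obtain ⟨Q, hQ⟩ := (hP.comap_of_injective H.subtype H.subtype_injective).exists_le_sylow
  refine ⟨_, ?_, isSylowOf_map_subtype Q⟩
  have := map_mono (f := H.subtype) hQ
  rwa [map_comap_eq, range_subtype, inf_eq_right.mpr hPH] at this

theorem exists_isSylowOf (p : ℕ) [Fact p.Prime] (H : Subgroup G) : ∃ Q, IsSylowOf p Q H :=
  ⟨_, isSylowOf_map_subtype default⟩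

theorem IsSylowOf.card_sylow (h : IsSylowOf p Q H) :
    Nat.card (Sylow p H) = (normalizer (Q : Set G)).relIndex H := by
  rw [h.toSylow.card_eq_index_normalizer, relIndex, subgroupOf_normalizer_eq h.le]
  rfl

theorem relIndex_eq_pow_of_isPGroup (hP : IsPGroup p P) (K : Subgroup G) :
    ∃ n : ℕ, K.relIndex P = p ^ n := by
  obtain ⟨n, hn⟩ := IsPGroup.iff_card.mp hP
  have h : K.relIndex P ∣ p ^ n := hn ▸ relIndex_dvd_card K P
  obtain ⟨m, -, hm⟩ := (Nat.dvd_prime_pow Fact.out).mp h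
  exact ⟨m, hm⟩

theorem IsSylowOf.eq_of_le (h : IsSylowOf p Q H) (hQ : Q ≤ L) (hL : L ≤ H) (hp : IsPGroup p L) :
    L ≤ Q := by
  obtain ⟨n, hn⟩ := relIndex_eq_pow_of_isPGroup hp Q
  have h1 := (h.of_le hQ hL).not_dvd
  rw [hn] at h1
  rw [← relIndex_eq_one, hn]
  rcases n with _ | n
  · rfl
  · exact absurd (dvd_pow_self p n.succ_ne_zero) h1

/-- The index of `M` in a subgroup of `PM` is a power of `p` when `P` is a `p`-group. -/
theorem exists_relIndex_eq_pow_of_le_sup (hP : IsPGroup p P) {M : Subgroup G}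
    (hn : P ≤ normalizer (M : Set G)) (hH : H ≤ P ⊔ M) :
    ∃ n : ℕ, (H ⊓ M).relIndex H = p ^ n := by
  obtain ⟨n, hn'⟩ := relIndex_eq_pow_of_isPGroup hP M
  have h1 : M.relIndex (H ⊔ M) ∣ M.relIndex (P ⊔ M) :=
    Dvd.intro _ (relIndex_mul_relIndex M (H ⊔ M) (P ⊔ M) le_sup_right (sup_le hH le_sup_right))
  rw [relIndex_sup_of_le_normalizer hn, relIndex_sup_of_le_normalizer
    (hH.trans (sup_le hn le_normalizer)), hn'] at h1
  obtain ⟨m, -, hm⟩ := (Nat.dvd_prime_pow Fact.out).mp h1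
  exact ⟨m, by rw [inf_relIndex_left, hm]⟩

/-- If `H = QK` with `Q` a Sylow `p`-subgroup of `H` and `K` normal in `H`, then the number of
Sylow `p`-subgroups of `H` is the index of `N_K(Q)` in `K`. -/
theorem IsSylowOf.card_sylow_eq_relIndex (h : IsSylowOf p Q H) (hK : K ≤ H)
    (hn : H ≤ normalizer (K : Set G)) (hs : H ≤ Q ⊔ K) :
    Nat.card (Sylow p H) = (normalizer (Q : Set G)).relIndex K := by
  rw [h.card_sylow]
  exact relIndex_eq_of_le_inf_sup hK hn
    (hs.trans (sup_le_sup_right (le_inf le_normalizer h.le) K))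

theorem IsSylowOf.card_sylow_mul_card (h : IsSylowOf p Q H) (hK : K ≤ H)
    (hn : H ≤ normalizer (K : Set G)) (hs : H ≤ Q ⊔ K) :
    Nat.card (Sylow p H) * Nat.card ↥(K ⊓ normalizer (Q : Set G)) = Nat.card K := by
  rw [h.card_sylow_eq_relIndex hK hn hs, mul_comm, ← inf_relIndex_left]
  exact card_mul_relIndex inf_le_left

theorem card_sylow_of_isPGroup {X : Type*} [Group X] [Finite X] (h : IsPGroup p X) :
    Nat.card (Sylow p X) = 1 := by
  have : IsPGroup p (⊤ : Subgroup X) := h.to_subgroup _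
  obtain ⟨Q, hQ⟩ := this.exists_le_sylow
  have hQ' : ((Q : Subgroup X) : Subgroup X) = ⊤ := top_le_iff.mp hQ
  have : (Q : Subgroup X).Normal := hQ' ▸ inferInstance
  have := Q.unique_of_normal this
  exact Nat.card_unique

theorem IsSylowOf.exists_conj_eq (hP : IsSylowOf p P H) (hQ : IsSylowOf p Q H) :
    ∃ x ∈ H, MulAut.conj x • P = Q := by
  obtain ⟨x, hx⟩ := MulAction.exists_smul_eq H hP.toSylow hQ.toSylow
  refine ⟨x, x.2, ?_⟩
  have h1 : MulAut.conj x • P.subgroupOf H = Q.subgroupOf H :=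
    congrArg (fun R : Sylow p H ↦ (R : Subgroup H)) hx
  have h2 := congrArg (Subgroup.map H.subtype) h1
  rw [conj_smul_subgroupOf hP.le, subgroupOf_map_subtype, subgroupOf_map_subtype,
    inf_eq_left.mpr hQ.le, inf_eq_left.mpr (conj_smul_le_of_le hP.le x)] at h2
  exact h2

end Sylow

/-! ### Sylow numbers and homomorphisms -/

section DivSyl

variable {p : ℕ} [Fact p.Prime] {X Y : Type*} [Group X] [Group Y] [Finite X] [Finite Y]

theorem card_sylow_congr (e : X ≃* Y) : Nat.card (Sylow p X) = Nat.card (Sylow p Y) :=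
  le_antisymm
    (Nat.card_le_card_of_surjective _ (Sylow.mapSurjective_surjective (f := e.symm.toMonoidHom)
      e.symm.surjective p))
    (Nat.card_le_card_of_surjective _ (Sylow.mapSurjective_surjective (f := e.toMonoidHom)
      e.surjective p))

theorem card_sylow_subgroupOf {H K : Subgroup X} (h : K ≤ H) :
    Nat.card (Sylow p (K.subgroupOf H)) = Nat.card (Sylow p K) :=
  card_sylow_congr (subgroupOfEquivOfLe h)

theorem divSyl_subgroup_iff {H : Subgroup X} :
    DivSyl p H ↔ ∀ K ≤ H, Nat.card (Sylow p K) ∣ Nat.card (Sylow p H) := by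
  refine ⟨fun h K hK ↦ card_sylow_subgroupOf (p := p) hK ▸ h (K.subgroupOf H), fun h K ↦ ?_⟩
  rw [card_sylow_congr (K.equivMapOfInjective H.subtype H.subtype_injective)]
  exact h _ (map_subtype_le K)

/-- The number of Sylow `p`-subgroups of `H` is that of the image of `H` under a homomorphism
times that of the product of a Sylow `p`-subgroup with the kernel. -/
theorem card_sylow_eq_mul (f : X →* Y) {Q H : Subgroup X} (hQ : IsSylowOf p Q H) :
    Nat.card (Sylow p H) =
      Nat.card (Sylow p (H.map f)) * Nat.card (Sylow p ↥(Q ⊔ (H ⊓ f.ker))) := by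
  set K := H ⊓ f.ker with hKdef
  set L := Q ⊔ K with hLdef
  set T := H ⊓ normalizer (L : Set X) with hTdef
  have hKn : H ≤ normalizer (K : Set X) := by
    rw [hKdef]
    exact le_trans (le_inf le_normalizer le_normalizer_of_normal) inf_normalizer_le_normalizer_inf
  have hLH : L ≤ H := sup_le hQ.le inf_le_left
  have hLT : L ≤ T := le_inf hLH le_normalizer
  have hQL : IsSylowOf p Q L := hQ.of_le le_sup_left hLH
  have hmapL : L.map f = Q.map f := by
    rw [hLdef, Subgroup.map_sup, sup_eq_left, map_le_iff_le_comap]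
    intro x hx
    rw [mem_comap, (MonoidHom.mem_ker).mp hx.2]
    exact one_mem _
  have hmap : IsSylowOf p (Q.map f) (H.map f) := by
    refine ⟨map_mono hQ.le, hQ.isPGroup.map f, fun hd ↦ hQ.not_dvd (hd.trans ?_)⟩
    rw [← relIndex_comap]
    exact relIndex_dvd_of_le_left H (le_comap_map f Q)
  -- The Sylow `p`-subgroups of the image correspond to the conjugates of `L` in `H`.
  have hnorm : ∀ h ∈ H, f h ∈ normalizer ((Q.map f : Subgroup Y) : Set Y) ↔
      h ∈ normalizer (L : Set X) := by
    intro h hh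
    constructor
    · intro hf
      refine mem_normalizer_fintype fun l hl ↦ ?_
      have h1 : f (h * l * h⁻¹) ∈ Q.map f := by
        rw [map_mul, map_mul, map_inv]
        exact (mem_normalizer_iff.mp hf _).mp (hmapL ▸ mem_map_of_mem f hl)
      obtain ⟨q, hq, e⟩ := h1
      have : h * l * h⁻¹ = q * (q⁻¹ * (h * l * h⁻¹)) := by group
      rw [SetLike.mem_coe, this]
      refine mul_mem (mem_sup_left hq) (mem_sup_right (mem_inf.mpr ⟨?_, ?_⟩))
      · exact mul_mem (inv_mem (hQ.le hq)) (mul_mem (mul_mem hh (hLH hl)) (inv_mem hh))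
      · rw [MonoidHom.mem_ker, map_mul, map_inv, e, inv_mul_cancel]
    · intro hn
      rw [← hmapL]
      exact le_normalizer_map f ⟨h, hn, rfl⟩
  have h1 : (normalizer ((Q.map f : Subgroup Y) : Set Y)).relIndex (H.map f) = T.relIndex H := by
    rw [← relIndex_comap, ← inf_relIndex_left]
    congr 1
    ext x
    simp only [mem_inf, mem_comap, hTdef]
    exact and_congr_right fun hx ↦ hnorm x hx
  -- Frattini's argument.
  have hF : T ≤ (normalizer (Q : Set X) ⊓ T) ⊔ L := by
    intro t ht
    have h1 : IsSylowOf p (MulAut.conj t • Q) L := by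
      have := hQL.conj_smul t
      rwa [mem_normalizer_iff_conj_smul.mp ht.2] at this
    obtain ⟨x, hx, e⟩ := h1.exists_conj_eq hQL
    rw [← mul_smul, ← map_mul, ← mem_normalizer_iff_conj_smul] at e
    have : t = x⁻¹ * (x * t) := by group
    rw [this]
    exact mul_mem (mem_sup_right (inv_mem hx))
      (mem_sup_left ⟨e, mul_mem (hLT hx) ht⟩)
  have h2 : (normalizer (Q : Set X)).relIndex T = (normalizer (Q : Set X)).relIndex L :=
    relIndex_eq_of_le_inf_sup hLT inf_le_right hF
  have h3 : H ⊓ normalizer (Q : Set X) ≤ T := fun x hx ↦ by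
    refine ⟨hx.1, ?_⟩
    exact normalizer_inf_normalizer_le_normalizer_sup Q K ⟨hx.2, hKn hx.1⟩
  have h4 : (H ⊓ normalizer (Q : Set X)).relIndex T = (normalizer (Q : Set X)).relIndex T := by
    rw [← inf_relIndex_right, ← inf_relIndex_right (normalizer (Q : Set X))]
    congr 1
    rw [inf_comm H, inf_assoc, inf_eq_right.mpr (show T ≤ H from inf_le_left)]
  rw [hQ.card_sylow, hmap.card_sylow, hQL.card_sylow, h1, ← h2, mul_comm, ← inf_relIndex_left H,
    ← relIndex_mul_relIndex _ T H h3 inf_le_left, h4]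

theorem divSyl_congr (e : X ≃* Y) (h : DivSyl p X) : DivSyl p Y := fun H ↦ by
  rw [← card_sylow_congr e, card_sylow_congr (p := p) (e.symm.subgroupMap H)]
  exact h _

theorem divSyl_of_isPGroup (h : IsPGroup p X) : DivSyl p X := fun H ↦ by
  rw [card_sylow_of_isPGroup (h.to_subgroup H)]
  exact one_dvd _

/-- The property `DivSyl` passes from a quotient `Y` of `X` to `X` if it holds for the product of
each Sylow `p`-subgroup with the kernel. -/
theorem divSyl_of_surjective {f : X →* Y} (hf : Function.Surjective f) (hY : DivSyl p Y)
    (h : ∀ P : Subgroup X, IsSylowOf p P ⊤ → DivSyl p ↥(P ⊔ f.ker)) : DivSyl p X := by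
  intro H
  obtain ⟨Q, hQ⟩ := exists_isSylowOf p H
  obtain ⟨P, hQP, hP⟩ := exists_isSylowOf_of_isPGroup hQ.isPGroup (le_top : Q ≤ ⊤)
  rw [← card_sylow_congr (topEquiv (G := X)), card_sylow_eq_mul f hQ, card_sylow_eq_mul f hP]
  refine Nat.mul_dvd_mul ?_ ?_
  · rw [map_top_of_surjective f hf, card_sylow_congr (topEquiv (G := Y))]
    exact hY _
  · rw [top_inf_eq]
    exact divSyl_subgroup_iff.mp (h P hP) _ (sup_le_sup hQP inf_le_right)

theorem divSyl_iff_of_surjective {f : X →* Y} (hf : Function.Surjective f)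
    (hk : IsPGroup p f.ker) : DivSyl p X ↔ DivSyl p Y := by
  refine ⟨fun h H ↦ ?_, fun h ↦ divSyl_of_surjective hf h fun P hP ↦
    divSyl_of_isPGroup (hP.isPGroup.to_sup_of_normal_right hk)⟩
  have key (K : Subgroup X) : Nat.card (Sylow p K) = Nat.card (Sylow p (K.map f)) := by
    obtain ⟨Q, hQ⟩ := exists_isSylowOf p K
    have : IsPGroup p ↥(Q ⊔ (K ⊓ f.ker)) :=
      (hQ.isPGroup.to_sup_of_normal_right hk).to_le (sup_le_sup_left inf_le_right Q)
    rw [card_sylow_eq_mul f hQ, card_sylow_of_isPGroup this, mul_one]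
  have h1 := h (H.comap f)
  rwa [key, map_comap_eq_self_of_surjective hf, ← card_sylow_congr (topEquiv (G := X)), key,
    map_top_of_surjective f hf, card_sylow_congr (topEquiv (G := Y))] at h1

end DivSyl

/-! ### Commuting families of centreless subgroups -/

section Family

variable {G : Type*} [Group G]

/-- A family of subgroups with trivial centres, distinct members of which commute elementwise. The
subgroup generated by such a family is its direct product. -/
structure IsCommutingFamily (𝒯 : Set (Subgroup G)) : Prop where
  centerless : ∀ S ∈ 𝒯, ∀ x ∈ S, x ∈ centralizer (S : Set G) → x = 1
  commute : ∀ S ∈ 𝒯, ∀ T ∈ 𝒯, S ≠ T → S ≤ centralizer (T : Set G)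

variable {𝒯 : Set (Subgroup G)}

theorem IsCommutingFamily.mono {𝒜 : Set (Subgroup G)} (h : IsCommutingFamily 𝒯) (h𝒜 : 𝒜 ⊆ 𝒯) :
    IsCommutingFamily 𝒜 :=
  ⟨fun S hS ↦ h.centerless S (h𝒜 hS), fun S hS T hT ↦ h.commute S (h𝒜 hS) T (h𝒜 hT)⟩

theorem le_centralizer_sSup {H : Subgroup G} (h : ∀ T ∈ 𝒯, H ≤ centralizer (T : Set G)) :
    H ≤ centralizer ((sSup 𝒯 : Subgroup G) : Set G) :=
  le_centralizer_iff.mpr (sSup_le fun T hT ↦ le_centralizer_iff.mp (h T hT))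

theorem IsCommutingFamily.sSup_le_normalizer (h : IsCommutingFamily 𝒯) {S : Subgroup G}
    (hS : S ∈ 𝒯) : sSup 𝒯 ≤ normalizer (S : Set G) := by
  refine sSup_le fun T hT ↦ ?_
  by_cases e : T = S
  · exact e ▸ le_normalizer
  · exact (h.commute T hT S hS e).trans (centralizer_le_normalizer _)

/-- The group generated by a commuting family of centreless subgroups has trivial centre. -/
theorem IsCommutingFamily.eq_one_of_mem_centralizer [Finite G] (h : IsCommutingFamily 𝒯) {w : G}
    (hw : w ∈ sSup 𝒯) (hc : ∀ T ∈ 𝒯, w ∈ centralizer (T : Set G)) : w = 1 := by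
  induction 𝒯, 𝒯.toFinite using Set.Finite.induction_on generalizing w with
  | empty => simpa using hw
  | @insert S 𝒜 hS _ ih =>
    have hSA : S ≤ centralizer ((sSup 𝒜 : Subgroup G) : Set G) := le_centralizer_sSup
      fun T hT ↦ h.commute S (Set.mem_insert _ _) T (Set.mem_insert_of_mem _ hT)
        fun e ↦ hS (e ▸ hT)
    rw [sSup_insert] at hw
    obtain ⟨s, hs, m, hm, rfl⟩ :=
      exists_mul_of_mem_sup (hSA.trans (centralizer_le_normalizer _)) hw
    have hmS : m ∈ centralizer (S : Set G) := le_centralizer_iff.mp hSA hm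
    have hsS : s ∈ centralizer (S : Set G) :=
      (mul_mem_cancel_right hmS).mp (hc S (Set.mem_insert _ _))
    have hs1 : s = 1 := h.centerless S (Set.mem_insert _ _) s hs hsS
    subst hs1
    rw [one_mul] at hc ⊢
    exact ih (h.mono (Set.subset_insert _ _)) hm fun T hT ↦ hc T (Set.mem_insert_of_mem _ hT)

/-- An element of the direct product with prescribed components: each quotient `(f T)⁻¹ y` lies in
the product of the members other than `T`, which is expressed as centralizing `T`. -/
theorem IsCommutingFamily.exists_mem_sSup [Finite G] (h : IsCommutingFamily 𝒯) {L : Subgroup G}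
    {f : Subgroup G → G} (hf : ∀ T ∈ 𝒯, f T ∈ T ⊓ L) :
    ∃ y ∈ sSup 𝒯 ⊓ L, ∀ T ∈ 𝒯, (f T)⁻¹ * y ∈ centralizer (T : Set G) := by
  induction 𝒯, 𝒯.toFinite using Set.Finite.induction_on with
  | empty => exact ⟨1, one_mem _, fun T hT ↦ hT.elim⟩
  | @insert S 𝒜 hS _ ih =>
    obtain ⟨y, hy, hyc⟩ := ih (h.mono (Set.subset_insert _ _))
      fun T hT ↦ hf T (Set.mem_insert_of_mem _ hT)
    have hSA : ∀ T ∈ 𝒜, S ≤ centralizer (T : Set G) := fun T hT ↦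
      h.commute S (Set.mem_insert _ _) T (Set.mem_insert_of_mem _ hT) fun e ↦ hS (e ▸ hT)
    have hfS := hf S (Set.mem_insert _ _)
    have hyS : y ∈ centralizer (S : Set G) :=
      le_centralizer_iff.mp (le_centralizer_sSup hSA) hy.1
    refine ⟨f S * y, ⟨?_, mul_mem hfS.2 hy.2⟩, ?_⟩
    · rw [sSup_insert]
      exact mul_mem (mem_sup_left hfS.1) (mem_sup_right hy.1)
    · rintro T (rfl | hT)
      · rwa [inv_mul_cancel_left]
      · have hcomm : f S * y = y * f S := (mem_centralizer_iff.mp hyS _ hfS.1)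
        rw [hcomm, ← mul_assoc]
        exact mul_mem (hyc T hT) (hSA T hT hfS.1)

theorem IsCommutingFamily.sSup_inf_sSup [Finite G] (h : IsCommutingFamily 𝒯)
    {𝒜 ℬ : Set (Subgroup G)} (h𝒜 : 𝒜 ⊆ 𝒯) (hℬ : ℬ ⊆ 𝒯) (hd : Disjoint 𝒜 ℬ) :
    sSup 𝒜 ⊓ sSup ℬ = ⊥ := by
  rw [eq_bot_iff]
  rintro x ⟨hxA, hxB⟩
  refine mem_bot.mpr ((h.mono h𝒜).eq_one_of_mem_centralizer hxA fun T hT ↦ ?_)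
  have : T ≤ centralizer ((sSup ℬ : Subgroup G) : Set G) := le_centralizer_sSup fun U hU ↦
    h.commute T (h𝒜 hT) U (hℬ hU) fun e ↦ Set.disjoint_left.mp hd hT (e ▸ hU)
  exact le_centralizer_iff.mp this hxB

end Family

/-! ### Orbits of subgroups under conjugation -/

section Orbit

variable {G : Type*} [Group G]

/-- The set of conjugates of the subgroup `S` by the elements of the subgroup `P`. -/
def conjOrbit (P S : Subgroup G) : Set (Subgroup G) :=
  {T | ∃ u ∈ P, MulAut.conj u • S = T}

theorem self_mem_conjOrbit (P S : Subgroup G) : S ∈ conjOrbit P S :=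
  ⟨1, one_mem P, by rw [map_one, one_smul]⟩

theorem conjOrbit_mono {P Q : Subgroup G} (h : Q ≤ P) (S : Subgroup G) :
    conjOrbit Q S ⊆ conjOrbit P S := fun _ ⟨u, hu, e⟩ ↦ ⟨u, h hu, e⟩

theorem conj_smul_mem_conjOrbit {P S T : Subgroup G} (hT : T ∈ conjOrbit P S) {u : G}
    (hu : u ∈ P) : MulAut.conj u • T ∈ conjOrbit P S := by
  obtain ⟨v, hv, rfl⟩ := hT
  exact ⟨u * v, mul_mem hu hv, by rw [map_mul, mul_smul]⟩

theorem mem_conj_smul_iff {S : Subgroup G} {u x : G} :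
    x ∈ MulAut.conj u • S ↔ u⁻¹ * x * u ∈ S := by
  rw [mem_pointwise_smul_iff_inv_smul_mem, ← map_inv, MulAut.smul_def, MulAut.conj_apply, inv_inv]

theorem mem_centralizer_conj_smul_iff {S : Subgroup G} {u x : G} :
    x ∈ centralizer ((MulAut.conj u • S : Subgroup G) : Set G) ↔
      u⁻¹ * x * u ∈ centralizer (S : Set G) := by
  simp only [mem_centralizer_iff]
  constructor
  · intro h s hs
    have := h (u * s * u⁻¹) (mem_conj_smul_iff.mpr (by simpa [mul_assoc] using hs))
    calc s * (u⁻¹ * x * u) = u⁻¹ * ((u * s * u⁻¹) * x) * u := by group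
      _ = u⁻¹ * x * u * s := by rw [this]; group
  · intro h s hs
    have := h _ (mem_conj_smul_iff.mp hs)
    calc s * x = u * ((u⁻¹ * s * u) * (u⁻¹ * x * u)) * u⁻¹ := by group
      _ = x * s := by rw [this]; group

/-- A family of subgroups permuted by `P` generates a subgroup normalized by `P`. -/
theorem le_normalizer_sSup {P : Subgroup G} {𝒯 : Set (Subgroup G)}
    (h : ∀ T ∈ 𝒯, ∀ u ∈ P, MulAut.conj u • T ∈ 𝒯) :
    P ≤ normalizer ((sSup 𝒯 : Subgroup G) : Set G) := by
  refine le_normalizer_iff.mpr fun u hu k hk ↦ ?_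
  have hle : sSup 𝒯 ≤ (sSup 𝒯).comap (MulAut.conj u).toMonoidHom := sSup_le fun T hT t ht ↦
    le_sSup (h T hT u hu) (mem_conj_smul_iff.mpr (by simpa [mul_assoc] using ht))
  exact hle hk

theorem normalizer_le_normalizer_centralizer (S : Subgroup G) :
    normalizer (S : Set G) ≤ normalizer ((centralizer (S : Set G) : Subgroup G) : Set G) := by
  refine le_normalizer_iff.mpr fun u hu k hk ↦ ?_
  rw [← mem_normalizer_iff_conj_smul.mp hu, mem_centralizer_conj_smul_iff]
  simpa [mul_assoc] using hk

/-- Two groups which agree modulo a group normalizing `S` have the same orbit on `S`. -/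
theorem conjOrbit_subset_of_le_sup {P Q N S : Subgroup G} (h : P ≤ Q ⊔ N)
    (hQ : Q ≤ normalizer (N : Set G)) (hN : N ≤ normalizer (S : Set G)) :
    conjOrbit P S ⊆ conjOrbit Q S := by
  rintro T ⟨u, hu, rfl⟩
  obtain ⟨a, ha, b, hb, rfl⟩ := exists_mul_of_mem_sup hQ (h hu)
  exact ⟨a, ha, by rw [map_mul, mul_smul, mem_normalizer_iff_conj_smul.mp (hN hb)]⟩

variable [Finite G] {p : ℕ} {P Q S H : Subgroup G}

/-- An element `w` of the direct product of the `Q`-conjugates of `S` all of whose components lie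
in `Q` belongs to `Q`. The condition refers only to the `S`-components of the `Q`-conjugates of
`w`. -/
theorem mem_of_forall_conj (h : IsCommutingFamily (conjOrbit Q S)) {w : G}
    (hw : w ∈ sSup (conjOrbit Q S))
    (hz : ∀ u ∈ Q, ∃ z ∈ S ⊓ Q, z⁻¹ * (u⁻¹ * w * u) ∈ centralizer (S : Set G)) : w ∈ Q := by
  have key : ∀ T ∈ conjOrbit Q S, ∃ z ∈ T ⊓ Q, z⁻¹ * w ∈ centralizer (T : Set G) := by
    rintro T ⟨u, hu, rfl⟩
    obtain ⟨z, hzm, hzc⟩ := hz u hu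
    refine ⟨u * z * u⁻¹, mem_inf.mpr ⟨mem_conj_smul_iff.mpr ?_, ?_⟩, mem_centralizer_conj_smul_iff.mpr ?_⟩
    · simpa [mul_assoc] using hzm.1
    · exact mul_mem (mul_mem hu hzm.2) (inv_mem hu)
    · convert hzc using 1; group
  choose! f hf hfc using key
  obtain ⟨y, hy, hyc⟩ := h.exists_mem_sSup hf
  have : y⁻¹ * w = 1 := h.eq_one_of_mem_centralizer (mul_mem (inv_mem hy.1) hw) fun T hT ↦ by
    have : y⁻¹ * w = ((f T)⁻¹ * y)⁻¹ * ((f T)⁻¹ * w) := by group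
    rw [this]
    exact mul_mem (inv_mem (hyc T hT)) (hfc T hT)
  rw [← inv_mul_eq_one.mp this]
  exact hy.2

/-- Every element of `H ∩ S` that normalizes `N_Q(S)` is the `S`-component of an element of the
direct product of the `Q`-conjugates of `S` that lies in `H` and normalizes `Q`: take the product of
conjugates over a transversal of `N_Q(S)` in `Q`. -/
theorem exists_mem_normalizer_of_mem (h : IsCommutingFamily (conjOrbit Q S)) (hQ : Q ≤ H) {x : G}
    (hxS : x ∈ S) (hxH : x ∈ H)
    (hxn : x ∈ normalizer ((Q ⊓ normalizer (S : Set G) : Subgroup G) : Set G)) :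
    ∃ y ∈ sSup (conjOrbit Q S) ⊓ H ⊓ normalizer (Q : Set G),
      x⁻¹ * y ∈ centralizer (S : Set G) := by
  have hrep : ∀ T ∈ conjOrbit Q S, ∃ c, c ∈ Q ∧ MulAut.conj c • S = T := fun T hT ↦ hT
  choose! c hcQ hcS using hrep
  have hf : ∀ T ∈ conjOrbit Q S, c T * x * (c T)⁻¹ ∈ T ⊓ H := fun T hT ↦ by
    refine mem_inf.mpr ⟨?_, mul_mem (mul_mem (hQ (hcQ T hT)) hxH) (inv_mem (hQ (hcQ T hT)))⟩
    have : c T * x * (c T)⁻¹ ∈ MulAut.conj (c T) • S :=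
      mem_conj_smul_iff.mpr (by simpa [mul_assoc] using hxS)
    rwa [hcS T hT] at this
  obtain ⟨y, hy, hyc⟩ := h.exists_mem_sSup hf
  -- the `S`-component of each conjugate of `y` is `x` up to a factor in `S ∩ Q`
  have hcomp : ∀ u ∈ Q, ∃ z ∈ S ⊓ Q, (x * z)⁻¹ * (u⁻¹ * y * u) ∈ centralizer (S : Set G) := by
    intro u hu
    have hT : MulAut.conj u • S ∈ conjOrbit Q S := ⟨u, hu, rfl⟩
    set T := MulAut.conj u • S with hTdef
    have hr : (c T)⁻¹ * u ∈ Q ⊓ normalizer (S : Set G) := by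
      refine mem_inf.mpr ⟨mul_mem (inv_mem (hcQ T hT)) hu, ?_⟩
      rw [mem_normalizer_iff_conj_smul, map_mul, mul_smul, ← hTdef, map_inv, inv_smul_eq_iff,
        hcS T hT]
    set r := (c T)⁻¹ * u with hrdef
    have hxr : x⁻¹ * r⁻¹ * x ∈ Q ⊓ normalizer (S : Set G) := by
      have := (mem_normalizer_iff.mp (inv_mem hxn) r⁻¹).mp (inv_mem hr)
      rwa [inv_inv] at this
    refine ⟨x⁻¹ * (r⁻¹ * x * r), mem_inf.mpr ⟨?_, ?_⟩, ?_⟩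
    · refine mul_mem (inv_mem hxS) ?_
      have := (mem_normalizer_iff.mp (inv_mem hr.2) x).mp hxS
      rwa [inv_inv] at this
    · have : x⁻¹ * (r⁻¹ * x * r) = (x⁻¹ * r⁻¹ * x) * r := by group
      rw [this]
      exact mul_mem hxr.1 hr.1
    · have := mem_centralizer_conj_smul_iff.mp (hyc T hT)
      convert this using 1
      rw [hrdef]; group
  have hyn : y ∈ normalizer (Q : Set G) := by
    rw [← inv_mem_iff]
    refine mem_normalizer_fintype fun q hq ↦ ?_
    have hyq : q * y * q⁻¹ ∈ sSup (conjOrbit Q S) :=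
      (mem_normalizer_iff.mp (le_normalizer_sSup (fun T hT u hu ↦
        conj_smul_mem_conjOrbit hT hu) hq) y).mp hy.1
    have hw : y⁻¹ * (q * y * q⁻¹) ∈ Q := by
      refine mem_of_forall_conj h (mul_mem (inv_mem hy.1) hyq) fun u hu ↦ ?_
      obtain ⟨z, hz, hzc⟩ := hcomp u hu
      obtain ⟨z', hz', hzc'⟩ := hcomp (q⁻¹ * u) (mul_mem (inv_mem hq) hu)
      refine ⟨z⁻¹ * z', mul_mem (inv_mem hz) hz', ?_⟩
      -- with `a = (xz)⁻¹ yᵘ` and `b = (xz')⁻¹ yᵛ`, the element is `(z⁻¹z')⁻¹ a⁻¹ (z⁻¹z') b`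
      have hn : z⁻¹ * z' ∈ normalizer ((centralizer (S : Set G) : Subgroup G) : Set G) :=
        normalizer_le_normalizer_centralizer S (le_normalizer (mul_mem (inv_mem hz.1) hz'.1))
      have := (mem_normalizer_iff.mp (inv_mem hn) _).mp (inv_mem hzc)
      convert mul_mem this hzc' using 1
      group
    have : y⁻¹ * q * y⁻¹⁻¹ = y⁻¹ * (q * y * q⁻¹) * q := by group
    rw [SetLike.mem_coe, this]
    exact mul_mem hw hq
  obtain ⟨z, hz, hzc⟩ := hcomp 1 (one_mem Q)
  refine ⟨y * z⁻¹, mem_inf.mpr ⟨mem_inf.mpr ⟨mul_mem hy.1 ?_, mul_mem hy.2 (inv_mem (hQ hz.2))⟩,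
    mul_mem hyn (inv_mem (le_normalizer hz.2))⟩, ?_⟩
  · exact inv_mem (le_sSup (self_mem_conjOrbit Q S) hz.1)
  · have hn : z ∈ normalizer ((centralizer (S : Set G) : Subgroup G) : Set G) :=
      normalizer_le_normalizer_centralizer S (le_normalizer hz.1)
    convert (mem_normalizer_iff.mp hn _).mp hzc using 1
    group

end Orbit

/-! ### Sylow numbers for a single orbit -/

section OrbitCount

variable {G : Type*} [Group G] {p : ℕ} {P Q S H : Subgroup G}

theorem card_eq_relIndex_centralizer {A : Subgroup G}
    (hS : ∀ x ∈ S, x ∈ centralizer (S : Set G) → x = 1) (hA : A ≤ S) :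
    (centralizer (S : Set G)).relIndex A = Nat.card A := by
  rw [← relIndex_bot_left, ← inf_relIndex_right]
  congr 1
  exact eq_bot_iff.mpr fun x hx ↦ mem_bot.mpr (hS x (hA hx.2) hx.1)

/-- Every element generated by a commuting family has an `S`-component. -/
theorem IsCommutingFamily.exists_component {𝒯 : Set (Subgroup G)} (h : IsCommutingFamily 𝒯)
    (hS : S ∈ 𝒯) {x : G} (hx : x ∈ sSup 𝒯) :
    ∃ s ∈ S, s⁻¹ * x ∈ centralizer (S : Set G) := by
  have hle : sSup 𝒯 ≤ S ⊔ centralizer (S : Set G) := sSup_le fun T hT ↦ by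
    by_cases e : T = S
    · exact e ▸ le_sup_left
    · exact (h.commute T hT S hS e).trans le_sup_right
  obtain ⟨s, hs, c, hc, rfl⟩ := exists_mul_of_mem_sup
    (le_normalizer.trans (normalizer_le_normalizer_centralizer S)) (hle hx)
  exact ⟨s, hs, by rwa [inv_mul_cancel_left]⟩

theorem le_normalizer_sSup_conjOrbit (P S : Subgroup G) :
    P ≤ normalizer ((sSup (conjOrbit P S) : Subgroup G) : Set G) :=
  le_normalizer_sSup fun _ hT _ hu ↦ conj_smul_mem_conjOrbit hT hu

variable [Finite G]

/-- For `S` normal in `M` and `H ≤ N_G(M)`, the group `N_Q(S)` is a Sylow `p`-subgroup of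
`N_Q(S)(H ∩ S)`, because `Q ∩ S` is one of `H ∩ S`. -/
theorem IsSylowOf.sup_inf {M : Subgroup G} (hQ : IsSylowOf p Q H) (hSM : S ≤ M)
    (hMS : M ≤ normalizer (S : Set G)) (hHM : H ≤ normalizer (M : Set G)) :
    IsSylowOf p (Q ⊓ normalizer (S : Set G)) ((Q ⊓ normalizer (S : Set G)) ⊔ (H ⊓ S)) := by
  have hKn : H ≤ normalizer ((H ⊓ M : Subgroup G) : Set G) :=
    (le_inf le_normalizer hHM).trans inf_normalizer_le_normalizer_inf
  have hAn : H ⊓ M ≤ normalizer ((H ⊓ S : Subgroup G) : Set G) :=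
    (inf_le_inf le_normalizer hMS).trans inf_normalizer_le_normalizer_inf
  have hRn : Q ⊓ normalizer (S : Set G) ≤ normalizer ((H ⊓ S : Subgroup G) : Set G) :=
    (inf_le_inf_right _ (hQ.le.trans le_normalizer)).trans inf_normalizer_le_normalizer_inf
  have h1 := (hQ.inf_of_normal inf_le_left hKn).inf_of_normal (inf_le_inf_left H hSM) hAn
  refine ⟨le_sup_left, hQ.isPGroup.to_le inf_le_left, fun hd ↦ h1.not_dvd (hd.trans ?_)⟩
  rw [relIndex_eq_of_le_inf_sup le_sup_right (sup_le hRn le_normalizer)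
    (sup_le_sup_right (le_inf le_rfl le_sup_left) _)]
  exact relIndex_dvd_of_le_left _ (le_inf (inf_le_left.trans inf_le_left)
    ((inf_le_right.trans inf_le_right).trans le_normalizer))

variable [Fact p.Prime]

/-- The `S`-component of an element of a Sylow `p`-subgroup `P` of `PM` lies in `P`, where `M` is
the direct product of the `P`-conjugates of `S`. -/
theorem component_mem (h : IsCommutingFamily (conjOrbit P S))
    (hP : IsSylowOf p P (P ⊔ sSup (conjOrbit P S))) {s z : G} (hs : s ∈ S)
    (hz : z ∈ P ⊓ sSup (conjOrbit P S)) (hc : s⁻¹ * z ∈ centralizer (S : Set G)) : s ∈ P := by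
  set M := sSup (conjOrbit P S) with hM
  have hSmem := self_mem_conjOrbit P S
  have hSM : S ≤ M := le_sSup hSmem
  have hMS : M ≤ normalizer (S : Set G) := h.sSup_le_normalizer hSmem
  have hPM : IsSylowOf p (P ⊓ M) M := hP.inf_of_normal le_sup_right
    (sup_le (le_normalizer_sSup_conjOrbit P S) le_normalizer)
  have hPS : IsSylowOf p (P ⊓ M ⊓ S) S := hPM.inf_of_normal hSM hMS
  have hMC := hMS.trans (normalizer_le_normalizer_centralizer S)
  -- the projection of `P ∩ M` to `S` is a `p`-group containing the Sylow subgroup `P ∩ S` of `S`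
  set J := S ⊓ ((P ⊓ M) ⊔ centralizer (S : Set G)) with hJ
  have hJp : IsPGroup p J := by
    have h1 : (centralizer (S : Set G)).relIndex J ∣ Nat.card ↥(P ⊓ M) := by
      refine relIndex_dvd_card_of_exists (inf_le_left.trans (hSM.trans hMC))
        (inf_le_right.trans hMC) fun x hx ↦ ?_
      obtain ⟨y, hy, c, hc, e⟩ := exists_mul_of_mem_sup (inf_le_right.trans hMC) hx.2
      refine ⟨y, hy, ?_⟩
      rw [← e]
      have h2 := inv_mem hc
      have : (y * c)⁻¹ * y = c⁻¹ := by group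
      rwa [this]
    rw [card_eq_relIndex_centralizer (h.centerless S hSmem) inf_le_left] at h1
    obtain ⟨n, hn⟩ := IsPGroup.iff_card.mp hPM.isPGroup
    exact IsPGroup.of_card_dvd_pow (hn ▸ h1)
  have hle : P ⊓ M ⊓ S ≤ J := le_inf inf_le_right (inf_le_left.trans le_sup_left)
  refine (hPS.eq_of_le hle inf_le_left hJp (mem_inf.mpr ⟨hs, ?_⟩)).1.1
  have : s = z * (s⁻¹ * z)⁻¹ := by group
  rw [this]
  exact mul_mem (mem_sup_left hz) (mem_sup_right (inv_mem hc))

/-- Up to a factor which is a power of `p`, the order of `N_M(P)` divides the order of its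
projection to `S`, which normalizes `N_P(S)`. -/
theorem card_inf_normalizer_dvd (h : IsCommutingFamily (conjOrbit P S))
    (hP : IsSylowOf p P (P ⊔ sSup (conjOrbit P S))) :
    ∃ a : ℕ, Nat.card ↥(sSup (conjOrbit P S) ⊓ normalizer (P : Set G)) ∣
      p ^ a * Nat.card ↥(S ⊓
        normalizer ((P ⊓ normalizer (S : Set G) : Subgroup G) : Set G)) := by
  set M := sSup (conjOrbit P S) with hM
  set C := centralizer (S : Set G) with hC
  have hSmem := self_mem_conjOrbit P S
  have hMS : M ≤ normalizer (S : Set G) := h.sSup_le_normalizer hSmem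
  have hNC := normalizer_le_normalizer_centralizer S
  have hPM : P ≤ normalizer (M : Set G) := le_normalizer_sSup_conjOrbit P S
  -- commutators of `N_M(P)` with `P` lie in `P ∩ M`
  have hcomm : ∀ x ∈ M ⊓ normalizer (P : Set G), ∀ r ∈ P, x⁻¹ * (r * x * r⁻¹) ∈ P ⊓ M := by
    intro x hx r hr
    refine mem_inf.mpr ⟨?_, mul_mem (inv_mem hx.1) ((mem_normalizer_iff.mp (hPM hr) x).mp hx.1)⟩
    have h1 := (mem_normalizer_iff.mp (inv_mem hx.2) r).mp hr
    have : x⁻¹ * (r * x * r⁻¹) = x⁻¹ * r * x⁻¹⁻¹ * r⁻¹ := by group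
    rw [this]
    exact mul_mem h1 (inv_mem hr)
  have h1 : C.relIndex (M ⊓ normalizer (P : Set G)) ∣ Nat.card ↥(S ⊓
      normalizer ((P ⊓ normalizer (S : Set G) : Subgroup G) : Set G)) := by
    refine relIndex_dvd_card_of_exists (inf_le_left.trans (hMS.trans hNC))
      (inf_le_left.trans (le_normalizer.trans hNC)) fun x hx ↦ ?_
    obtain ⟨s, hs, hsc⟩ := h.exists_component hSmem hx.1
    refine ⟨s, mem_inf.mpr ⟨hs, ?_⟩, ?_⟩
    · rw [← inv_mem_iff]
      refine mem_normalizer_fintype fun r hr ↦ mem_inf.mpr ?_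
      have hrS : s⁻¹ * (r * s * r⁻¹) ∈ S :=
        mul_mem (inv_mem hs) ((mem_normalizer_iff.mp hr.2 s).mp hs)
      have hcc : (s⁻¹ * (r * s * r⁻¹))⁻¹ * (x⁻¹ * (r * x * r⁻¹)) ∈ C := by
        have e1 := (mem_normalizer_iff.mp (hNC (inv_mem (le_normalizer hrS))) _).mp (inv_mem hsc)
        have e2 := (mem_normalizer_iff.mp (hNC hr.2) _).mp hsc
        convert mul_mem e1 e2 using 1
        group
      have hsP := component_mem h hP hrS (hcomm x hx r hr.1) hcc
      have e : s⁻¹ * r * s⁻¹⁻¹ = s⁻¹ * (r * s * r⁻¹) * r := by group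
      rw [e]
      exact ⟨mul_mem hsP hr.1, mul_mem (le_normalizer hrS) hr.2⟩
    · have e2 : x⁻¹ * s = (s⁻¹ * x)⁻¹ := by group
      rw [e2]
      exact inv_mem hsc
  -- the kernel of the projection of `N_M(P)` to `S` is a `p`-group, as all components lie in `P`
  have h2 : C ⊓ (M ⊓ normalizer (P : Set G)) ≤ P := by
    intro x hx
    refine mem_of_forall_conj h hx.2.1 fun u hu ↦ ?_
    have hz := hcomm x hx.2 u⁻¹ (inv_mem hu)
    rw [inv_inv] at hz
    obtain ⟨s, hs, hsc⟩ := h.exists_component hSmem hz.2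
    refine ⟨s, mem_inf.mpr ⟨hs, component_mem h hP hs hz hsc⟩, ?_⟩
    have e1 := (mem_normalizer_iff.mp (hNC (le_normalizer (inv_mem hs))) _).mp hx.1
    convert mul_mem e1 hsc using 1
    group
  obtain ⟨a, ha⟩ := IsPGroup.iff_card.mp (hP.isPGroup.to_le h2)
  refine ⟨a, ?_⟩
  rw [← card_mul_relIndex (inf_le_right : C ⊓ (M ⊓ normalizer (P : Set G)) ≤ _), ha,
    inf_relIndex_right]
  exact Nat.mul_dvd_mul_left _ h1

/-- The number of Sylow `p`-subgroups of `H`, where `H/(H ∩ M)` is a `p`-group, in terms of the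
number of those of `N_Q(S)(H ∩ S)` for a normal subgroup `S` of `M`. -/
theorem IsSylowOf.card_sylow_mul_eq {M : Subgroup G} (hQ : IsSylowOf p Q H) (hSM : S ≤ M)
    (hMS : M ≤ normalizer (S : Set G)) (hHM : H ≤ normalizer (M : Set G))
    (hs : H ≤ Q ⊔ (H ⊓ M)) :
    Nat.card (Sylow p H) * Nat.card ↥(H ⊓ M ⊓ normalizer (Q : Set G)) =
      S.relIndex (H ⊓ M) * Nat.card (Sylow p ↥((Q ⊓ normalizer (S : Set G)) ⊔ (H ⊓ S))) *
        Nat.card ↥(H ⊓ S ⊓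
          normalizer ((Q ⊓ normalizer (S : Set G) : Subgroup G) : Set G)) := by
  have hKn : H ≤ normalizer ((H ⊓ M : Subgroup G) : Set G) :=
    (le_inf le_normalizer hHM).trans inf_normalizer_le_normalizer_inf
  have hRn : Q ⊓ normalizer (S : Set G) ≤ normalizer ((H ⊓ S : Subgroup G) : Set G) :=
    (inf_le_inf_right _ (hQ.le.trans le_normalizer)).trans inf_normalizer_le_normalizer_inf
  have h1 : S.relIndex (H ⊓ M) = (H ⊓ S).relIndex (H ⊓ M) := by
    rw [← inf_relIndex_right]
    congr 1
    rw [inf_left_comm, inf_eq_left.mpr hSM]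
  rw [hQ.card_sylow_mul_card inf_le_left hKn hs, mul_assoc,
    (hQ.sup_inf hSM hMS hHM).card_sylow_mul_card le_sup_right (sup_le hRn le_normalizer) le_rfl,
    h1, mul_comm, card_mul_relIndex (inf_le_inf_left H hSM)]

/-- The group generated by a `p`-group `P` and the commuting `P`-conjugates of `S` inherits
`DivSyl` from the products of `S` with the `p`-groups normalizing it. -/
theorem divSyl_sup_conjOrbit (hP : IsPGroup p P) (h : IsCommutingFamily (conjOrbit P S))
    (hloc : ∀ R : Subgroup G, IsPGroup p R → R ≤ normalizer (S : Set G) → DivSyl p ↥(R ⊔ S)) :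
    DivSyl p ↥(P ⊔ sSup (conjOrbit P S)) := by
  rw [divSyl_subgroup_iff]
  intro H hH
  set M := sSup (conjOrbit P S) with hM
  have hSmem := self_mem_conjOrbit P S
  have hSM : S ≤ M := le_sSup hSmem
  have hMS : M ≤ normalizer (S : Set G) := h.sSup_le_normalizer hSmem
  have hPM : P ≤ normalizer (M : Set G) := le_normalizer_sSup_conjOrbit P S
  have hXM : P ⊔ M ≤ normalizer (M : Set G) := sup_le hPM le_normalizer
  have hMX : (P ⊔ M) ⊓ M = M := inf_eq_right.mpr le_sup_right
  have hSX : (P ⊔ M) ⊓ S = S := inf_eq_right.mpr (hSM.trans le_sup_right)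
  obtain ⟨Q, hQ⟩ := exists_isSylowOf p H
  obtain ⟨P', hQP, hP'⟩ := exists_isSylowOf_of_isPGroup hQ.isPGroup (hQ.le.trans hH)
  have hXP' : P ⊔ M ≤ P' ⊔ ((P ⊔ M) ⊓ M) :=
    hP'.le_sup (exists_relIndex_eq_pow_of_le_sup hP hPM le_rfl)
  have hX : P ⊔ M = P' ⊔ M := le_antisymm (hXP'.trans_eq (by rw [hMX])) (sup_le hP'.le le_sup_right)
  have hO : conjOrbit P S = conjOrbit P' S :=
    (conjOrbit_subset_of_le_sup (le_sup_left.trans hX.le) (hP'.le.trans hXM) hMS).antisymm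
      (conjOrbit_subset_of_le_sup hP'.le hPM hMS)
  have h' : IsCommutingFamily (conjOrbit P' S) := hO ▸ h
  have hM' : sSup (conjOrbit P' S) = M := by rw [← hO]
  have hP'' : IsSylowOf p P' (P' ⊔ sSup (conjOrbit P' S)) := by rwa [hM', ← hX]
  have hQO := conjOrbit_mono hQP S
  -- `|N_A(N_Q(S))|` divides `|N_K(Q)|`, where `A = H ∩ S` and `K = H ∩ M`
  have hup : Nat.card ↥(H ⊓ S ⊓
      normalizer ((Q ⊓ normalizer (S : Set G) : Subgroup G) : Set G)) ∣
      Nat.card ↥(H ⊓ M ⊓ normalizer (Q : Set G)) := by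
    have hNC := normalizer_le_normalizer_centralizer S
    rw [← card_eq_relIndex_centralizer (h.centerless S hSmem)
      (inf_le_left.trans inf_le_right)]
    refine relIndex_dvd_card_of_exists
      ((inf_le_left.trans inf_le_right).trans (le_normalizer.trans hNC))
      ((inf_le_left.trans inf_le_right).trans (hMS.trans hNC)) fun x hx ↦ ?_
    obtain ⟨y, hy, hyc⟩ := exists_mem_normalizer_of_mem (h'.mono hQO) hQ.le hx.1.2 hx.1.1 hx.2
    exact ⟨y, mem_inf.mpr ⟨mem_inf.mpr ⟨hy.1.2, hM' ▸ sSup_le_sSup hQO hy.1.1⟩, hy.2⟩, hyc⟩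
  have countH := hQ.card_sylow_mul_eq hSM hMS (hH.trans hXM)
    (hQ.le_sup (exists_relIndex_eq_pow_of_le_sup hP hPM hH))
  have countX := hP'.card_sylow_mul_eq hSM hMS hXM hXP'
  obtain ⟨a, ha⟩ := card_inf_normalizer_dvd h' hP''
  rw [hM'] at ha
  rw [hMX, hSX] at countX
  -- the local hypothesis compares the two factors belonging to `S`
  have hlocal : Nat.card (Sylow p ↥((Q ⊓ normalizer (S : Set G)) ⊔ (H ⊓ S))) ∣
      Nat.card (Sylow p ↥((P' ⊓ normalizer (S : Set G)) ⊔ S)) :=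
    divSyl_subgroup_iff.mp (hloc _ (hP'.isPGroup.to_le inf_le_left) inf_le_right) _
      (sup_le_sup (inf_le_inf_right _ hQP) inf_le_right)
  have hindex : S.relIndex (H ⊓ M) ∣ S.relIndex M := by
    have : (S.subgroupOf M).Normal := normal_subgroupOf_of_le_normalizer hMS
    rw [← relIndex_subgroupOf (inf_le_right : H ⊓ M ≤ M)]
    exact relIndex_dvd_index_of_normal _ _
  have hd1 : Nat.card (Sylow p H) ∣ S.relIndex (H ⊓ M) *
      Nat.card (Sylow p ↥((Q ⊓ normalizer (S : Set G)) ⊔ (H ⊓ S))) := by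
    refine Nat.dvd_of_mul_dvd_mul_right
      (Nat.card_pos (α := ↥(H ⊓ M ⊓ normalizer (Q : Set G)))) ?_
    rw [countH]
    exact Nat.mul_dvd_mul_left _ hup
  have hd2 : S.relIndex M * Nat.card (Sylow p ↥((P' ⊓ normalizer (S : Set G)) ⊔ S)) ∣
      Nat.card (Sylow p ↥(P ⊔ M)) * p ^ a := by
    refine Nat.dvd_of_mul_dvd_mul_right (Nat.card_pos (α := ↥(S ⊓
      normalizer ((P' ⊓ normalizer (S : Set G) : Subgroup G) : Set G)))) ?_
    rw [← countX, mul_assoc]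
    exact Nat.mul_dvd_mul_left _ ha
  have hcop : Nat.Coprime (Nat.card (Sylow p H)) (p ^ a) :=
    (((Nat.Prime.coprime_iff_not_dvd Fact.out).mpr (not_dvd_card_sylow p H)).pow_left a).symm
  exact hcop.dvd_of_dvd_mul_right (hd1.trans ((Nat.mul_dvd_mul hindex hlocal).trans hd2))

end OrbitCount

/-! ### Several orbits -/

section Family

variable {G : Type*} [Group G] [Finite G] {p : ℕ} [Fact p.Prime] {P : Subgroup G}
  {𝒯 : Set (Subgroup G)}

/-- If `M` and `M'` are normalized by the `p`-group `P` and intersect trivially, then `DivSyl`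
passes from `PM'` to `PM'M/M`, since the kernel of the projection is a `p`-group. -/
theorem divSyl_quotient_of_sup {M M' X : Subgroup G} (hP : IsPGroup p P)
    (hM' : P ≤ normalizer (M' : Set G)) (hd : M ⊓ M' = ⊥) (hX : X = P ⊔ M' ⊔ M)
    [(M.subgroupOf X).Normal] (h : DivSyl p ↥(P ⊔ M')) : DivSyl p (X ⧸ M.subgroupOf X) := by
  have hle : P ⊔ M' ≤ X := hX ▸ le_sup_left
  have hMX : M ≤ X := hX ▸ le_sup_right
  set f : ↥(P ⊔ M') →* X ⧸ M.subgroupOf X :=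
    (QuotientGroup.mk' (M.subgroupOf X)).comp (inclusion hle) with hf
  have hker : f.ker = M.subgroupOf (P ⊔ M') := by
    ext x
    rw [MonoidHom.mem_ker, hf, MonoidHom.comp_apply, QuotientGroup.mk'_apply,
      QuotientGroup.eq_one_iff, mem_subgroupOf, mem_subgroupOf, coe_inclusion]
  have hsurj : Function.Surjective f := by
    intro y
    obtain ⟨⟨x, hx⟩, rfl⟩ := QuotientGroup.mk_surjective y
    have hMn : X ≤ normalizer (M : Set G) := normal_subgroupOf_iff_le_normalizer hMX |>.mp ‹_›
    obtain ⟨a, ha, b, hb, rfl⟩ := exists_mul_of_mem_sup (hle.trans hMn) (hX ▸ hx)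
    refine ⟨⟨a, ha⟩, ?_⟩
    rw [hf, MonoidHom.comp_apply, QuotientGroup.mk'_apply, QuotientGroup.eq, mem_subgroupOf]
    simpa using hb
  refine (divSyl_iff_of_surjective hsurj ?_).mp h
  rw [hker]
  obtain ⟨n, hn⟩ := exists_relIndex_eq_pow_of_le_sup hP hM' (inf_le_left : (P ⊔ M') ⊓ M ≤ _)
  refine IsPGroup.of_card (n := n) ?_
  rw [← hn, inf_assoc, hd, inf_bot_eq, relIndex_bot_left, ← card_map_of_injective
    (P ⊔ M').subtype_injective, subgroupOf_map_subtype, inf_comm]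

/-- The group generated by a `p`-group `P` and a `P`-invariant commuting family inherits `DivSyl`
from the products of the members with the `p`-groups normalizing them: the orbits of `P` on the
family can be treated one at a time. -/
theorem divSyl_sup_sSup (h : IsCommutingFamily 𝒯) (hP : IsPGroup p P)
    (hinv : ∀ T ∈ 𝒯, ∀ u ∈ P, MulAut.conj u • T ∈ 𝒯)
    (hloc : ∀ T ∈ 𝒯, ∀ R : Subgroup G, IsPGroup p R → R ≤ normalizer (T : Set G) →
      DivSyl p ↥(R ⊔ T)) : DivSyl p ↥(P ⊔ sSup 𝒯) := by
  induction hn : 𝒯.ncard using Nat.strong_induction_on generalizing 𝒯 with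
  | _ n ih =>
  subst hn
  obtain rfl | ⟨S, hS⟩ := 𝒯.eq_empty_or_nonempty
  · rw [sSup_empty, sup_bot_eq]
    exact divSyl_of_isPGroup hP
  set 𝒪 := conjOrbit P S with h𝒪
  have h𝒪𝒯 : 𝒪 ⊆ 𝒯 := by
    rintro T ⟨u, hu, rfl⟩
    exact hinv S hS u hu
  have hSO : S ∈ 𝒪 := self_mem_conjOrbit P S
  set M := sSup 𝒪 with hM
  set M' := sSup (𝒯 \ 𝒪) with hM'
  set X := P ⊔ sSup 𝒯 with hXdef
  have hinv' : ∀ T ∈ 𝒯 \ 𝒪, ∀ u ∈ P, MulAut.conj u • T ∈ 𝒯 \ 𝒪 := by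
    refine fun T hT u hu ↦ ⟨hinv T hT.1 u hu, fun hc ↦ hT.2 ?_⟩
    have := conj_smul_mem_conjOrbit hc (inv_mem hu)
    rwa [map_inv, inv_smul_smul] at this
  have hsup : sSup 𝒯 = M' ⊔ M := by
    rw [hM', hM, ← sSup_union, Set.sdiff_union_of_subset h𝒪𝒯]
  have hX : X = P ⊔ M' ⊔ M := by rw [hXdef, hsup, sup_assoc]
  have hMX : M ≤ X := hX ▸ le_sup_right
  have hdis : M ⊓ M' = ⊥ := h.sSup_inf_sSup h𝒪𝒯 Set.sdiff_subset Set.disjoint_sdiff_right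
  have hPM : P ≤ normalizer (M : Set G) := le_normalizer_sSup_conjOrbit P S
  have hPM' : P ≤ normalizer (M' : Set G) := le_normalizer_sSup hinv'
  have hM'M : M' ≤ centralizer (M : Set G) := le_centralizer_sSup fun T hT ↦
    sSup_le fun U hU ↦ h.commute U hU.1 T (h𝒪𝒯 hT) fun e ↦ hU.2 (e ▸ hT)
  have hXM : X ≤ normalizer (M : Set G) := hX ▸
    sup_le (sup_le hPM (hM'M.trans (centralizer_le_normalizer _))) le_normalizer
  have hnormal : (M.subgroupOf X).Normal := normal_subgroupOf_of_le_normalizer hXM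
  have hsmall : DivSyl p ↥(P ⊔ M') := by
    refine ih _ ?_ (h.mono Set.sdiff_subset) hinv' (fun T hT ↦ hloc T hT.1) rfl
    exact Set.ncard_lt_ncard ⟨Set.sdiff_subset, fun hc ↦ (hc hS).2 hSO⟩
  refine divSyl_of_surjective (QuotientGroup.mk'_surjective (M.subgroupOf X))
    (divSyl_quotient_of_sup hP hPM' hdis hX hsmall) fun P' hP' ↦ ?_
  rw [QuotientGroup.ker_mk']
  -- pass from the Sylow subgroup `P'` of `X`, as a subgroup of `X`, to one of the ambient group
  set P₁ := P'.map X.subtype with hP₁def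
  have hP₁ : IsSylowOf p P₁ X := by
    refine ⟨map_subtype_le _, hP'.isPGroup.map _, ?_⟩
    rw [relIndex, subgroupOf, comap_map_eq_self_of_injective X.subtype_injective]
    simpa using hP'.not_dvd
  have hTX : sSup 𝒯 ≤ X := le_sup_right
  have hXn : X ≤ normalizer ((sSup 𝒯 : Subgroup G) : Set G) :=
    sup_le (le_normalizer_sSup hinv) le_normalizer
  have hXP₁ : X ≤ P₁ ⊔ sSup 𝒯 := by
    have := hP₁.le_sup (exists_relIndex_eq_pow_of_le_sup hP (le_normalizer_sSup hinv) le_rfl)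
    rwa [inf_eq_right.mpr hTX] at this
  have hTS := h.sSup_le_normalizer hS
  have hO : 𝒪 = conjOrbit P₁ S :=
    (conjOrbit_subset_of_le_sup (le_sup_left.trans hXP₁) (hP₁.le.trans hXn) hTS).antisymm
      (conjOrbit_subset_of_le_sup hP₁.le (le_normalizer_sSup hinv) hTS)
  have hfin := divSyl_sup_conjOrbit hP₁.isPGroup (hO ▸ h.mono h𝒪𝒯) (hloc S hS)
  rw [← hO, ← hM] at hfin
  have e : (P' ⊔ M.subgroupOf X).map X.subtype = P₁ ⊔ M := by
    rw [Subgroup.map_sup, subgroupOf_map_subtype, inf_eq_left.mpr hMX]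
  refine divSyl_congr ?_ hfin
  exact ((equivMapOfInjective _ X.subtype X.subtype_injective).trans
    (MulEquiv.subgroupCongr e)).symm

end Family

/-! ### Abelian normal subgroups -/

section Abelian

variable {G : Type*} [Group G] [Finite G] {p : ℕ} [Fact p.Prime] {P N : Subgroup G}

/-- If `N` is an abelian `q`-group with `q ≠ p` and `Q ≤ P`, then `N_N(P)` centralizes `P`, hence is
contained in `N_N(Q)`. -/
theorem divSyl_sup_of_commutative {q : ℕ} [Fact q.Prime] (hP : IsPGroup p P) (hN : IsPGroup q N)
    (hPN : P ≤ normalizer (N : Set G)) (hc : ∀ x ∈ N, ∀ y ∈ N, x * y = y * x) :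
    DivSyl p ↥(P ⊔ N) := by
  by_cases hpq : p = q
  · subst hpq
    exact divSyl_of_isPGroup (hP.to_sup_of_normal_right' hN hPN)
  rw [divSyl_subgroup_iff]
  intro H hH
  have hXN : P ⊔ N ≤ normalizer (N : Set G) := sup_le hPN le_normalizer
  obtain ⟨Q, hQ⟩ := exists_isSylowOf p H
  obtain ⟨P', hQP, hP'⟩ := exists_isSylowOf_of_isPGroup hQ.isPGroup (hQ.le.trans hH)
  have hMX : (P ⊔ N) ⊓ N = N := inf_eq_right.mpr le_sup_right
  have hKn : H ≤ normalizer ((H ⊓ N : Subgroup G) : Set G) :=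
    (le_inf le_normalizer (hH.trans hXN)).trans inf_normalizer_le_normalizer_inf
  have hXP' := hP'.le_sup (exists_relIndex_eq_pow_of_le_sup hP hPN le_rfl)
  rw [hMX] at hXP'
  rw [hQ.card_sylow_eq_relIndex inf_le_left hKn
      (hQ.le_sup (exists_relIndex_eq_pow_of_le_sup hP hPN hH)),
    hP'.card_sylow_eq_relIndex le_sup_right hXN hXP']
  have hle : normalizer (P' : Set G) ⊓ N ≤ normalizer (Q : Set G) ⊓ N := by
    refine le_inf ?_ inf_le_right
    intro x hx
    refine mem_normalizer_fintype fun y hy ↦ ?_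
    have hyP := hQP hy
    have hmem : x * y * x⁻¹ * y⁻¹ ∈ P' ⊓ N := by
      refine mem_inf.mpr ⟨mul_mem ((mem_normalizer_iff.mp hx.1 y).mp hyP) (inv_mem hyP), ?_⟩
      have h1 := (mem_normalizer_iff.mp (hXN (hP'.le hyP)) x⁻¹).mp (inv_mem hx.2)
      have : x * y * x⁻¹ * y⁻¹ = x * (y * x⁻¹ * y⁻¹) := by group
      rw [this]
      exact mul_mem hx.2 h1
    rw [(IsPGroup.disjoint_of_ne p q hpq _ _ hP'.isPGroup hN).eq_bot, mem_bot,
      mul_inv_eq_one] at hmem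
    rw [SetLike.mem_coe, hmem]
    exact hy
  have hnormal : ((normalizer (Q : Set G)).subgroupOf N).Normal := by
    refine ⟨fun n hn g ↦ ?_⟩
    have : g * n * g⁻¹ = n := by
      rw [show g * n = n * g from Subtype.ext (hc g g.2 n n.2), mul_inv_cancel_right]
    rwa [this]
  refine dvd_trans (b := (normalizer (Q : Set G)).relIndex N) ?_ ?_
  · rw [← relIndex_subgroupOf (inf_le_right : H ⊓ N ≤ N)]
    exact relIndex_dvd_index_of_normal _ _
  · rw [← inf_relIndex_right, ← inf_relIndex_right (normalizer (P' : Set G))]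
    exact relIndex_dvd_of_le_left _ hle

end Abelian

/-! ### Subnormal subgroups -/

section Subnormal

variable {G : Type*} [Group G]

theorem isSylowOf_inf_of_isSubnormal [Finite G] {q : ℕ} {P H : Subgroup G}
    (hP : IsSylowOf q P ⊤) (hH : H.IsSubnormal) : IsSylowOf q (P ⊓ H) H := by
  induction hH with
  | top => rwa [inf_top_eq]
  | step H K hHK _ hN ih =>
    have := ih.inf_of_normal hHK ((normal_subgroupOf_iff_le_normalizer hHK).mp hN)
    rwa [inf_assoc, inf_eq_right.mpr hHK] at this

/-- The normal closure of a subnormal `q`-subgroup is a `q`-group, since every Sylow `q`-subgroup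
contains it. -/
theorem isPGroup_normalClosure_of_isSubnormal [Finite G] {q : ℕ} [Fact q.Prime] {S : Subgroup G}
    (hS : S.IsSubnormal) (hq : IsPGroup q S) : IsPGroup q (normalClosure (S : Set G)) := by
  obtain ⟨P, hP⟩ := exists_isSylowOf q (⊤ : Subgroup G)
  refine hP.isPGroup.to_le ((closure_le _).mpr fun x hx ↦ ?_)
  obtain ⟨a, ha, hax⟩ := Group.mem_conjugatesOfSet_iff.mp hx
  obtain ⟨c, rfl⟩ := isConj_iff.mp hax
  have hsub : (MulAut.conj c • S).IsSubnormal :=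
    hS.map (f := (MulAut.conj c).toMonoidHom) (MulAut.conj c).surjective
  have hpc : IsPGroup q ↥(MulAut.conj c • S) := hq.map _
  exact ((isSylowOf_inf_of_isSubnormal hP hsub).eq_of_le inf_le_right le_rfl hpc
    (mem_conj_smul_iff.mpr (by simpa [mul_assoc] using ha))).1

/-- The iterated commutators `[N, S, …, S]`. -/
def iteratedCommutator (N S : Subgroup G) : ℕ → Subgroup G
  | 0 => N
  | n + 1 => ⁅iteratedCommutator N S n, S⁆

theorem exists_iteratedCommutator_le {H S : Subgroup G} (hH : H.IsSubnormal) (hS : S ≤ H)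
    (N : Subgroup G) : ∃ n, iteratedCommutator N S n ≤ H := by
  induction hH with
  | top => exact ⟨0, le_top⟩
  | step H K hHK _ hN ih =>
    obtain ⟨n, hn⟩ := ih (hS.trans hHK)
    refine ⟨n + 1, ?_⟩
    have hKH : K ≤ normalizer (H : Set G) := (normal_subgroupOf_iff_le_normalizer hHK).mp hN
    exact (commutator_mono hn hS).trans (le_normalizer_iff_commutator_le_right.mp hKH)

theorem commutator_self_of_isSimpleGroup {S : Subgroup G} [IsSimpleGroup S]
    (hc : ¬ ∀ x y : S, x * y = y * x) : ⁅S, S⁆ = S := by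
  rw [← map_subtype_commutator]
  rcases (inferInstance : (commutator S).Normal).eq_bot_or_eq_top with h | h
  · refine absurd (fun x y ↦ ?_) hc
    have : ⁅x, y⁆ ∈ commutator S := commutator_mem_commutator (mem_top x) (mem_top y)
    rw [h, mem_bot] at this
    exact commutatorElement_eq_one_iff_mul_comm.mp this
  · rw [h, ← MonoidHom.range_eq_map, range_subtype]

/-- A nonabelian simple subnormal subgroup `S` either lies in or centralizes any subgroup `N` that
it normalizes: the iterated commutators of `N` with `S` end up in `N ∩ S`, and as `S` is perfect,
the three subgroups lemma allows to go back when this intersection is trivial. -/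
theorem le_or_le_centralizer_of_isSubnormal {S N : Subgroup G} [IsSimpleGroup S]
    (hc : ¬ ∀ x y : S, x * y = y * x) (hS : S.IsSubnormal) (hN : S ≤ normalizer (N : Set G)) :
    S ≤ N ∨ S ≤ centralizer (N : Set G) := by
  have hnormal : (N.subgroupOf S).Normal := normal_subgroupOf_of_le_normalizer hN
  rcases hnormal.eq_bot_or_eq_top with h | h
  · right
    rw [subgroupOf_eq_bot] at h
    obtain ⟨n, hn⟩ := exists_iteratedCommutator_le hS le_rfl N
    have hleN : ∀ k, iteratedCommutator N S k ≤ N := fun k ↦ by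
      induction k with
      | zero => exact le_rfl
      | succ k ih =>
        exact (commutator_mono ih le_rfl).trans (le_normalizer_iff_commutator_le_left.mp hN)
    have hbot : iteratedCommutator N S (n + 1) = ⊥ := by
      have : iteratedCommutator N S n = ⊥ := eq_bot_iff.mpr ((le_inf (hleN n) hn).trans h.le_bot)
      rw [iteratedCommutator, this, commutator_bot_left]
    have hdown : ∀ k, iteratedCommutator N S (k + 1) = ⊥ → iteratedCommutator N S 1 = ⊥ := by
      intro k
      induction k with
      | zero => exact id
      | succ k ih =>
        intro hk
        refine ih ?_
        rw [iteratedCommutator, iteratedCommutator] at hk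
        have hk' : ⁅⁅S, iteratedCommutator N S k⁆, S⁆ = ⊥ := by
          rwa [commutator_comm S]
        have := commutator_commutator_eq_bot_of_rotate hk' hk
        rw [commutator_self_of_isSimpleGroup hc, commutator_comm] at this
        exact this
    have := hdown n hbot
    rw [iteratedCommutator, iteratedCommutator, commutator_comm] at this
    exact commutator_eq_bot_iff_le_centralizer.mp this
  · exact Or.inl (subgroupOf_eq_top.mp h)

/-- Two nonabelian simple subnormal subgroups coincide or commute. -/
theorem eq_or_le_centralizer_of_isSubnormal {S T : Subgroup G} [IsSimpleGroup S] [IsSimpleGroup T]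
    (hcS : ¬ ∀ x y : S, x * y = y * x) (hcT : ¬ ∀ x y : T, x * y = y * x) (hS : S.IsSubnormal)
    (hT : T.IsSubnormal) : S = T ∨ S ≤ centralizer (T : Set G) := by
  have key : ∀ S T : Subgroup G, IsSimpleGroup S → (¬ ∀ x y : S, x * y = y * x) → S.IsSubnormal →
      T.IsSubnormal → S ≤ T ∨ S ≤ centralizer (T : Set G) := by
    intro S T _ hcS hS hT
    induction hT with
    | top => exact Or.inl le_top
    | step H K hHK _ hN ih =>
      rcases ih with h | h
      · exact le_or_le_centralizer_of_isSubnormal hcS hS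
          (h.trans ((normal_subgroupOf_iff_le_normalizer hHK).mp hN))
      · exact Or.inr (h.trans (centralizer_le hHK))
  rcases key S T ‹_› hcS hS hT with h | h
  · rcases key T S ‹_› hcT hT hS with h' | h'
    · exact Or.inl (le_antisymm h h')
    · exact Or.inr (le_centralizer_iff.mp h')
  · exact Or.inr h

end Subnormal

/-! ### Minimal normal subgroups -/

section MinimalNormal

variable {G : Type*} [Group G]

theorem eq_one_of_mem_centralizer_of_isSimpleGroup {S : Subgroup G} [IsSimpleGroup S]
    (hc : ¬ ∀ x y : S, x * y = y * x) {x : G} (hx : x ∈ S) (hxc : x ∈ centralizer (S : Set G)) :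
    x = 1 := by
  have hmem : (⟨x, hx⟩ : S) ∈ center S :=
    mem_center_iff.mpr fun y ↦ Subtype.ext (mem_centralizer_iff.mp hxc y y.2)
  rcases (inferInstance : (center S).Normal).eq_bot_or_eq_top with h | h
  · rw [h, mem_bot] at hmem
    exact congrArg Subtype.val hmem
  · exact absurd (fun x y ↦ (mem_center_iff.mp (h ▸ mem_top y) x)) hc

/-- The conjugates of a nonabelian simple subnormal subgroup form a commuting family. -/
theorem isCommutingFamily_conjOrbit_of_isSubnormal {S : Subgroup G} [IsSimpleGroup S]
    (hc : ¬ ∀ x y : S, x * y = y * x) (hS : S.IsSubnormal) (P : Subgroup G) :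
    IsCommutingFamily (conjOrbit P S) := by
  have key : ∀ T ∈ conjOrbit P S,
      IsSimpleGroup T ∧ (¬ ∀ x y : T, x * y = y * x) ∧ T.IsSubnormal := by
    rintro T ⟨u, -, rfl⟩
    have e : S ≃* ↥(MulAut.conj u • S) := equivSMul (MulAut.conj u) S
    refine ⟨e.symm.isSimpleGroup, fun h ↦ hc fun x y ↦ e.injective ?_,
      hS.map (f := (MulAut.conj u).toMonoidHom) (MulAut.conj u).surjective⟩
    rw [map_mul, map_mul, h]
  refine ⟨fun T hT x hx hxc ↦ ?_, fun T hT U hU hne ↦ ?_⟩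
  · have := (key T hT).1
    exact eq_one_of_mem_centralizer_of_isSimpleGroup (key T hT).2.1 hx hxc
  · have := (key T hT).1
    have := (key U hU).1
    exact (eq_or_le_centralizer_of_isSubnormal (key T hT).2.1 (key U hU).2.1 (key T hT).2.2
      (key U hU).2.2).resolve_left hne

variable [Finite G] {p : ℕ} [Fact p.Prime]

/-- The local hypothesis on `S` passes to the conjugates of `S`. -/
theorem divSyl_sup_conj_smul {S : Subgroup G}
    (hloc : ∀ R : Subgroup G, IsPGroup p R → R ≤ normalizer (S : Set G) → DivSyl p ↥(R ⊔ S))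
    (u : G) {R : Subgroup G} (hR : IsPGroup p R)
    (hRn : R ≤ normalizer ((MulAut.conj u • S : Subgroup G) : Set G)) :
    DivSyl p ↥(R ⊔ MulAut.conj u • S) := by
  have h1 : (MulAut.conj u)⁻¹ • R ≤ normalizer (S : Set G) := by
    intro x hx
    have hx' := hRn (mem_inv_pointwise_smul_iff.mp hx)
    rw [mem_normalizer_iff_conj_smul] at hx' ⊢
    rw [MulAut.smul_def, MulAut.conj_apply, map_mul, map_mul, mul_smul, mul_smul, map_inv,
      inv_smul_smul] at hx'
    exact smul_left_cancel _ hx'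
  have hRu : IsPGroup p ↥((MulAut.conj u)⁻¹ • R) := hR.map _
  have h2 := hloc _ hRu h1
  refine divSyl_congr ?_ h2
  refine (equivSMul (MulAut.conj u) _).trans (MulEquiv.subgroupCongr ?_)
  rw [smul_sup, smul_inv_smul]

/-- A minimal normal subgroup `N` containing a simple subnormal subgroup `S` is either
abelian or the direct product of the conjugates of `S`; in the latter case `DivSyl` for `PN` follows
from the local hypothesis on `S`. -/
theorem divSyl_sup_of_minimal {N S P : Subgroup G} [N.Normal] [IsSimpleGroup S]
    (hmin : ∀ K : Subgroup G, K.Normal → K ≤ N → K = ⊥ ∨ K = N) (hSN : S ≤ N)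
    (hS : S.IsSubnormal)
    (hloc : (¬ ∀ x y : S, x * y = y * x) → ∀ R : Subgroup G, IsPGroup p R →
      R ≤ normalizer (S : Set G) → DivSyl p ↥(R ⊔ S))
    (hP : IsPGroup p P) : DivSyl p ↥(P ⊔ N) := by
  have hne : S ≠ ⊥ := (nontrivial_iff_ne_bot S).mp inferInstance
  by_cases hc : ∀ x y : S, x * y = y * x
  · -- an abelian chief factor is a `q`-group for a prime `q`, and it equals its centre
    let : CommGroup S := { (inferInstance : Group S) with mul_comm := hc }
    have hq : (Nat.card S).Prime := IsSimpleGroup.prime_card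
    set q := Nat.card S
    have : Fact q.Prime := ⟨hq⟩
    have hSq : IsPGroup q S := IsPGroup.of_card (n := 1) (pow_one _).symm
    have hcl : normalClosure (S : Set G) = N :=
      (hmin _ inferInstance (normalClosure_le_normal hSN)).resolve_left fun h ↦
        hne (eq_bot_iff.mpr (h ▸ le_normalClosure))
    have hNq : IsPGroup q N := hcl ▸ isPGroup_normalClosure_of_isSubnormal hS hSq
    have hNnt : Nontrivial N := (nontrivial_iff_ne_bot N).mpr fun h ↦
      hne (eq_bot_iff.mpr (h ▸ hSN))
    have hZ : (center N).map N.subtype = N := by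
      refine (hmin _ inferInstance (map_subtype_le _)).resolve_left fun h ↦ ?_
      have := hNq.bot_lt_center
      rw [map_eq_bot_iff_of_injective _ N.subtype_injective] at h
      exact this.ne' h
    refine divSyl_sup_of_commutative hP hNq le_normalizer_of_normal fun x hx y hy ↦ ?_
    rw [← hZ] at hy
    obtain ⟨z, hz, rfl⟩ := hy
    exact congrArg Subtype.val (mem_center_iff.mp hz ⟨x, hx⟩)
  · have hfam := isCommutingFamily_conjOrbit_of_isSubnormal hc hS (⊤ : Subgroup G)
    have hsup : sSup (conjOrbit ⊤ S) = N := by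
      have hnormal : (sSup (conjOrbit ⊤ S)).Normal := by
        rw [← normalizer_eq_top_iff, eq_top_iff]
        exact le_normalizer_sSup_conjOrbit ⊤ S
      refine (hmin _ hnormal (sSup_le ?_)).resolve_left fun h ↦
        hne (eq_bot_iff.mpr (h ▸ le_sSup (self_mem_conjOrbit ⊤ S)))
      rintro T ⟨u, -, rfl⟩
      rw [← mem_normalizer_iff_conj_smul.mp (le_normalizer_of_normal (H := N) (mem_top u))]
      exact pointwise_smul_le_pointwise_smul_iff.mpr hSN
    rw [← hsup]
    refine divSyl_sup_sSup hfam hP (fun T hT u _ ↦ conj_smul_mem_conjOrbit hT (mem_top u)) ?_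
    rintro T ⟨u, -, rfl⟩ R hR hRn
    exact divSyl_sup_conj_smul (hloc hc) u hR hRn

end MinimalNormal

/-! ### Induced automorphisms of a factor -/

section Factor

variable {G : Type*} [Group G]

/-- For `B` normal in `G`, the section `T/B` is isomorphic to the image of `T` in `G/B`. -/
noncomputable def sectionEquivMap (T B : Subgroup G) [B.Normal] [(B.subgroupOf T).Normal] :
    T ⧸ B.subgroupOf T ≃* T.map (QuotientGroup.mk' B) :=
  (QuotientGroup.quotientMulEquivOfEq (by
    ext x
    simp [mem_subgroupOf, MonoidHom.mem_ker, Subtype.ext_iff])).trans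
    (QuotientGroup.quotientKerEquivOfSurjective ((QuotientGroup.mk' B).subgroupMap T)
      ((QuotientGroup.mk' B).subgroupMap_surjective T))

variable [Finite G] {p : ℕ} [Fact p.Prime]

/-- The hypothesis on the automorphism group of the nonabelian simple section `T/B`, transferred to
subgroups of `G/B`: for a `p`-subgroup `R` normalizing `T/B`, the group `R(T/B)` acts on `T/B` by
conjugation with image of the form `P Inn(T/B)`, and the kernel is a `p`-group because it meets `T/B`
trivially. -/
theorem divSyl_sup_map_of_inducedAut {T B : Subgroup G} [B.Normal] [(B.subgroupOf T).Normal]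
    (hBT : B ≤ T)
    [IsSimpleGroup (T ⧸ B.subgroupOf T)] (hc : ¬ ∀ x y : T ⧸ B.subgroupOf T, x * y = y * x)
    (h : ∀ P : Subgroup (MulAut (T ⧸ B.subgroupOf T)), P ≤ inducedAut T B → IsPGroup p P →
      DivSyl p ↥(P ⊔ (MulAut.conj : T ⧸ B.subgroupOf T →* MulAut (T ⧸ B.subgroupOf T)).range))
    {R : Subgroup (G ⧸ B)} (hR : IsPGroup p R)
    (hRn : R ≤ normalizer ((T.map (QuotientGroup.mk' B) : Subgroup (G ⧸ B)) : Set (G ⧸ B))) :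
    DivSyl p ↥(R ⊔ T.map (QuotientGroup.mk' B)) := by
  set S := T.map (QuotientGroup.mk' B) with hS
  set e := sectionEquivMap T B with he
  have hsimple : IsSimpleGroup S := e.symm.isSimpleGroup
  have hcS : ¬ ∀ x y : S, x * y = y * x := fun hh ↦ hc fun x y ↦ e.injective (by
    rw [map_mul, map_mul, hh])
  have hle : R ⊔ S ≤ normalizer (S : Set (G ⧸ B)) := sup_le hRn le_normalizer
  set f : ↥(R ⊔ S) →* MulAut (T ⧸ B.subgroupOf T) :=
    ((MulAut.congr e.symm).toMonoidHom.comp (normalizerMonoidHom S)).comp (inclusion hle) with hf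
  have hfe : ∀ (x : ↥(R ⊔ S)) (a : T ⧸ B.subgroupOf T),
      (e (f x a) : G ⧸ B) = x * e a * (x : G ⧸ B)⁻¹ := by
    intro x a
    have : f x a = e.symm (normalizerMonoidHom S (inclusion hle x) (e a)) := rfl
    rw [this, MulEquiv.apply_symm_apply]
    rfl
  set P := (R.subgroupOf (R ⊔ S)).map f with hP
  have hPp : IsPGroup p P :=
    (hR.comap_of_injective (R ⊔ S).subtype (R ⊔ S).subtype_injective).map f
  have hPA : P ≤ inducedAut T B := by
    rintro _ ⟨r, hr, rfl⟩
    obtain ⟨x, hx⟩ := QuotientGroup.mk_surjective (r : G ⧸ B)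
    have hxT : x ∈ normalizer (T : Set G) := by
      have h1 : comap (QuotientGroup.mk' B) S = T := by
        rw [hS, comap_map_eq, QuotientGroup.ker_mk', sup_eq_left.mpr hBT]
      rw [← h1, ← comap_normalizer_eq_of_surjective _ (QuotientGroup.mk'_surjective B), mem_comap,
        QuotientGroup.mk'_apply, hx]
      exact hRn hr
    refine ⟨⟨x, mem_inf.mpr ⟨hxT, le_normalizer_of_normal (mem_top x)⟩⟩, ?_⟩
    refine MulEquiv.ext fun a ↦ e.injective (Subtype.ext ?_)
    rw [hfe, ← hx]
    induction a using QuotientGroup.induction_on with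
    | H a => rfl
  have hconj : (S.subgroupOf (R ⊔ S)).map f =
      (MulAut.conj : T ⧸ B.subgroupOf T →* MulAut (T ⧸ B.subgroupOf T)).range := by
    have hfs : ∀ (s : ↥(R ⊔ S)) (b : T ⧸ B.subgroupOf T), (s : G ⧸ B) = e b →
        f s = MulAut.conj b := fun s b hsb ↦ MulEquiv.ext fun a ↦ e.injective (Subtype.ext (by
      rw [hfe, hsb, MulAut.conj_apply, map_mul, map_mul, map_inv]; rfl))
    ext g
    constructor
    · rintro ⟨s, hs, rfl⟩
      exact ⟨e.symm ⟨s, hs⟩, (hfs s _ (by rw [MulEquiv.apply_symm_apply])).symm⟩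
    · rintro ⟨b, rfl⟩
      exact ⟨⟨e b, mem_sup_right (e b).2⟩, (e b).2, hfs _ b rfl⟩
  have hrange : f.range = P ⊔ (MulAut.conj : T ⧸ B.subgroupOf T →* _).range := by
    rw [← hconj, hP, ← Subgroup.map_sup, ← subgroupOf_sup le_sup_left le_sup_right,
      subgroupOf_self, MonoidHom.range_eq_map]
  have hker : IsPGroup p f.ker := by
    have hC : f.ker.map (R ⊔ S).subtype ⊓ S = ⊥ := by
      rw [eq_bot_iff]
      rintro _ ⟨⟨x, hx, rfl⟩, hxS⟩
      refine mem_bot.mpr (eq_one_of_mem_centralizer_of_isSimpleGroup hcS hxS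
        (mem_centralizer_iff.mpr fun s hs ↦ ?_))
      have h1 := hfe x (e.symm ⟨s, hs⟩)
      rw [show f x = 1 from hx, MulAut.one_apply, MulEquiv.apply_symm_apply] at h1
      exact (eq_mul_inv_iff_mul_eq.mp h1)
    obtain ⟨n, hn⟩ := exists_relIndex_eq_pow_of_le_sup hR hRn
      (map_subtype_le f.ker)
    rw [hC, relIndex_bot_left, card_map_of_injective (R ⊔ S).subtype_injective] at hn
    exact IsPGroup.of_card hn
  refine (divSyl_iff_of_surjective f.rangeRestrict_surjective ?_).mpr ?_
  · rwa [MonoidHom.ker_rangeRestrict]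
  · rw [hrange]
    exact h P hPA hPp

end Factor

/-! ### Composition series refining a chief series -/

section Series

variable {G : Type*} [Group G]

theorem isSubnormal_term (S : GroupCompositionSeries G) (i : Fin (S.length + 1)) :
    (S.term i).IsSubnormal := by
  induction i using Fin.reverseInduction with
  | last => rw [S.term_last]; exact IsSubnormal.top
  | cast i ih => exact IsSubnormal.step _ _ (S.term_lt i).le ih (S.normal i)

variable [Finite G] {p : ℕ} [Fact p.Prime]

/-- The inductive step along a chief factor `A/B`. Only the first composition factor above `B` is
used; as `B` is normal in `G`, the induced automorphisms of this factor are all those coming from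
the normalizer of the factor in `G/B`. -/
theorem divSyl_quotient_of_chiefFactor (S : GroupCompositionSeries G) (i : Fin S.length)
    {A B : Subgroup G} [A.Normal] [B.Normal] (hB : B = S.term i.castSucc)
    (hA : S.term i.succ ≤ A)
    (hmin : ∀ K : Subgroup G, K.Normal → B ≤ K → K ≤ A → K = B ∨ K = A)
    (h : (¬ ∀ x y : S.Factor i, x * y = y * x) →
      ∀ P : Subgroup (MulAut (S.Factor i)), P ≤ S.factorAut i → IsPGroup p P →
        DivSyl p ↥(P ⊔ (MulAut.conj : S.Factor i →* MulAut (S.Factor i)).range))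
    (hd : DivSyl p (G ⧸ A)) : DivSyl p (G ⧸ B) := by
  subst hB
  set B := S.term i.castSucc with hBdef
  set T := S.term i.succ with hT
  have hBT : B ≤ T := (S.term_lt i).le
  have := S.simple i
  set π := QuotientGroup.mk' B with hπ
  have hπs : Function.Surjective π := QuotientGroup.mk'_surjective B
  set e := sectionEquivMap T B
  have : IsSimpleGroup (T.map π) := e.symm.isSimpleGroup
  set f : G ⧸ B →* G ⧸ A := QuotientGroup.map B A (MonoidHom.id G) (hBT.trans hA) with hf
  have hfs : Function.Surjective f := by
    intro y
    obtain ⟨x, rfl⟩ := QuotientGroup.mk_surjective y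
    exact ⟨QuotientGroup.mk x, rfl⟩
  have hker : f.ker = A.map π := by
    rw [hf, QuotientGroup.ker_map]
    rfl
  have hnormal : (A.map π).Normal := hker ▸ inferInstance
  refine divSyl_of_surjective hfs hd fun P hP ↦ ?_
  rw [hker]
  refine divSyl_sup_of_minimal (S := T.map π) ?_ (map_mono hA)
    ((isSubnormal_term S i.succ).map hπs) (fun hc R hR hRn ↦ ?_) hP.isPGroup
  · intro K hK hKA
    have hBK : B ≤ K.comap π := (QuotientGroup.ker_mk' B).ge.trans (MonoidHom.ker_le_comap π K)
    have hKA' : K.comap π ≤ A := by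
      have := comap_mono (f := π) hKA
      rwa [comap_map_eq, hπ, QuotientGroup.ker_mk', sup_eq_left.mpr (hBT.trans hA)] at this
    rw [← map_comap_eq_self_of_surjective hπs K]
    rcases hmin _ (hK.comap π) hBK hKA' with h | h
    · left
      rw [h, hπ, QuotientGroup.map_mk'_self]
    · right
      rw [h]
  · have hcF : ¬ ∀ x y : S.Factor i, x * y = y * x := fun hh ↦ hc fun x y ↦ e.symm.injective (by
      rw [map_mul, map_mul]; exact hh _ _)
    exact divSyl_sup_map_of_inducedAut hBT hcF (h hcF) hR hRn

end Series

end SylowDivisibility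

open SylowDivisibility in
theorem theorem1 (p : ℕ) [Fact p.Prime] {G : Type*} [Group G] [Finite G]
    (S : GroupCompositionSeries G) (hS : S.IsRC)
    (h : ∀ i : Fin S.length, (¬ ∀ x y : S.Factor i, x * y = y * x) →
      ∀ P : Subgroup (MulAut (S.Factor i)), P ≤ S.factorAut i → IsPGroup p P →
        DivSyl p ↥(P ⊔ (MulAut.conj : S.Factor i →* MulAut (S.Factor i)).range)) :
    DivSyl p G := by
  obtain ⟨m, t, ht, hsub⟩ := hS
  have hnormal := ht.normal
  have hmono : StrictMono S.term := Fin.strictMono_iff_lt_succ.mpr S.term_lt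
  have key : ∀ j : Fin (m + 1), DivSyl p (G ⧸ t j) := by
    intro j
    induction j using Fin.reverseInduction with
    | last =>
      refine divSyl_of_isPGroup ?_
      have : Subsingleton (G ⧸ t (Fin.last m)) := by
        rw [ht.last]
        exact QuotientGroup.subsingleton_quotient_top
      exact IsPGroup.of_subsingleton p _
    | cast j ih =>
      obtain ⟨a, ha⟩ := hsub ⟨j.castSucc, rfl⟩
      obtain ⟨b, hb⟩ := hsub ⟨j.succ, rfl⟩
      have hab : a < b := hmono.lt_iff_lt.mp (by rw [ha, hb]; exact ht.lt j)
      obtain ⟨i, rfl⟩ := Fin.exists_castSucc_eq.mpr (ne_of_lt (hab.trans_le (Fin.le_last b)))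
      refine divSyl_quotient_of_chiefFactor S i ha.symm ?_ (ht.minimal j) (h i) ih
      rw [← hb]
      exact hmono.monotone (Fin.castSucc_lt_iff_succ_le.mp hab)
  have h0 := key 0
  have e : G ⧸ t 0 ≃* G :=
    (QuotientGroup.quotientMulEquivOfEq ht.zero).trans QuotientGroup.quotientBot
  exact divSyl_congr e h0
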